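/- \textbf{Setting.} Let $\mathcal H=\bigotimes_{i=1}^n\mathbb C^{2^q}$ and let $H=\sum_{b=1}^{n-1}H_{b,b+1}$ be a nearest-neighbour Hamiltonian on the open chain $[n]=\{1,\dots,n\}$: each $H_{b,b+1}$ is Hermitian, acts on the sites $b,b+1$ only, and has operator norm $\|H_{b,b+1}\|\le 1$. For $R\subseteq[n]$ let $H^R=\sum_{\{b,b+1\}\subseteq R}H_{b,b+1}$, regarded as an operator on $\mathcal H$. Fix an inverse temperature $\beta\ge 0$ and put $\rho=e^{-\beta H}/\mathrm{Tr}[e^{-\beta H}]$. For a full-rank state $\sigma$ let $\langle X,Y\rangle_\sigma=\mathrm{Tr}[X^\dagger\sigma^{1/2}Y\sigma^{1/2}]$ and $\|X\|_\sigma=\sqrt{\langle X,X\rangle_\sigma}$ be the KMS inner product and norm, and for a linear map $\mathcal N:\mathcal B(\mathcal H)\to\mathcal B(\mathcal H)$ let $\|\mathcal N\|_\sigma=\sup_{O\ne 0}\|\mathcal N[O]\|_\sigma/\|O\|_\sigma$. For $A\subseteq[n]$ the spectral conditional expectation $\tilde{\mathbb E}_A$ defined with respect to $H$ is $$\tilde{\mathbb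 E}_A[Y]=\sum_i\langle B^i,Y\rangle_\rho\,B^i ,$$ where $(B^i)_i$ is any basis, orthonormal for $\langle\cdot,\cdot\rangle_\rho$, of the space of operators supported on $[n]\setminus A$ (the map does not depend on the basis). Let $\tilde{\mathbb E}^{(R)}_A$ be the map defined in the same way with respect to $H^R$, i.e. with $\rho$ replaced by $e^{-\beta H^R}/\mathrm{Tr}[e^{-\beta H^R}]$. \textbf{Lemma (Quasi-Locality of the Spectral Conditional Expectation).} For every $\beta\ge0$ and $q$ there are constants $c_1\ge 1$ and $c_2,c_3>0$, depending only on $\beta$ and $q$, such that for every $n$, every $H$ as above and all $A\subseteq R\subseteq[n]$, $$\big\|\tilde{\mathbb E}_A-\tilde{\mathbb E}_A^{(R)}\big\|_\rho\le c_1^{|\partial R|}\exp\big(c_2|A|-c_3\,\ell\log\ell\big),\qquad \ell=\mathrm{dist}(A,[n]\setminus R)=\min_{i\in A,\;j\in[n]\setminus R}|i-j| ,$$ where $|\partial R|$ is the number of end-points of $R$ inside the chain, i.e. the number of links $\{b,b+1\}$ with exactly one site in $R$. If $A=\emptyset$ or $R=[n]$, so that $\ell=\infty$, the bound is read as $\tilde{\mathbb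 E}_A=\tilde{\mathbb E}_A^{(R)}$ (the left-hand side is $0$). -/

import Mathlib

open scoped ENNReal ComplexOrder MatrixOrder Matrix Matrix.Norms.L2Operator

/-- Configurations of the chain: labels of the product basis of `⊗_{i=1}^n ℂ^{2^q}`. -/
abbrev Config (n q : ℕ) : Type := Fin n → Fin (2 ^ q)

/-- The operators `𝓑(𝓗)` on `𝓗 = ⊗_{i=1}^n ℂ^{2^q}`, as matrices in the product basis. The norm
`‖·‖` on this type is the operator norm (of the Euclidean norm). -/
abbrev Op (n q : ℕ) : Type := Matrix (Config n q) (Config n q) ℂ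

/-- `M ⊗ I`: an operator on the sites in `S`, extended by the identity to the whole chain. -/
def extendOp {n q : ℕ} (S : Finset (Fin n)) :
    Matrix (S → Fin (2 ^ q)) (S → Fin (2 ^ q)) ℂ →ₗ[ℂ] Op n q where
  toFun M := Matrix.of fun x y =>
    if ∀ i, i ∉ S → x i = y i then M (fun i => x i) (fun i => y i) else 0
  map_add' M N := by
    ext x y
    simp only [Matrix.of_apply, Matrix.add_apply]
    split_ifs <;> simp
  map_smul' c M := by
    ext x y
    simp only [Matrix.of_apply, Matrix.smul_apply, RingHom.id_apply]
    split_ifs <;> simp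

/-- `𝓑(𝓗_S)`: the operators supported on the set of sites `S`. -/
def localOps {n : ℕ} (q : ℕ) (S : Finset (Fin n)) : Submodule ℂ (Op n q) :=
  LinearMap.range (extendOp (q := q) S)

/-- The left site of the `b`-th link. -/
def leftSite {n : ℕ} (b : Fin (n - 1)) : Fin n := ⟨b, by omega⟩

/-- The right site of the `b`-th link. -/
def rightSite {n : ℕ} (b : Fin (n - 1)) : Fin n := ⟨b + 1, by omega⟩

/-- A nearest-neighbour Hamiltonian on an open chain of `n` sites of local dimension `2 ^ q`,
given by its `n - 1` link terms. -/
structure ChainHamiltonian (n q : ℕ) where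
  /-- The link term acting on two neighbouring sites. -/
  link : Fin (n - 1) → Op n q
  isHermitian_link : ∀ b, (link b).IsHermitian
  link_mem : ∀ b, link b ∈ localOps q {leftSite b, rightSite b}
  norm_link_le : ∀ b, ‖link b‖ ≤ 1

/-- The KMS inner product `⟨X, Y⟩_ρ = Tr[X† ρ^{1/2} Y ρ^{1/2}]`. -/
noncomputable def kmsInner {n q : ℕ} (ρ X Y : Op n q) : ℂ :=
  (Xᴴ * CFC.sqrt ρ * Y * CFC.sqrt ρ).trace

/-- The KMS norm `‖X‖_ρ = √⟨X, X⟩_ρ`. -/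
noncomputable def kmsNorm {n q : ℕ} (ρ X : Op n q) : ℝ :=
  Real.sqrt (kmsInner ρ X X).re

/-- The KMS-induced norm `sup_O ‖N O‖_ρ / ‖O‖_ρ` of a superoperator, as an extended nonnegative
real, so that no boundedness is presupposed. -/
noncomputable def kmsSuperNorm {n q : ℕ} (ρ : Op n q) (N : Op n q →ₗ[ℂ] Op n q) : ℝ≥0∞ :=
  ⨆ O : Op n q, ENNReal.ofReal (kmsNorm ρ (N O) / kmsNorm ρ O)

/-- `B` is a basis of `𝓑(𝓗_S)` that is orthonormal for the KMS inner product of `ρ`. -/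
structure IsKMSOrthonormalBasis {n q : ℕ} {ι : Type*} [DecidableEq ι] (ρ : Op n q)
    (S : Finset (Fin n)) (B : ι → Op n q) : Prop where
  orthonormal : ∀ i j, kmsInner ρ (B i) (B j) = if i = j then 1 else 0
  span_eq : Submodule.span ℂ (Set.range B) = localOps q S

theorem kmsInner_add_right {n q : ℕ} (ρ X Y Z : Op n q) :
    kmsInner ρ X (Y + Z) = kmsInner ρ X Y + kmsInner ρ X Z := by
  simp [kmsInner, Matrix.mul_add, Matrix.add_mul]

theorem kmsInner_smul_right {n q : ℕ} (ρ : Op n q) (c : ℂ) (X Y : Op n q) :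
    kmsInner ρ X (c • Y) = c * kmsInner ρ X Y := by
  simp [kmsInner]

/-- The map `Y ↦ ∑ᵢ ⟨Bᵢ, Y⟩_ρ Bᵢ`. -/
noncomputable def kmsExpansion {n q : ℕ} {ι : Type*} [Fintype ι] (ρ : Op n q)
    (B : ι → Op n q) : Op n q →ₗ[ℂ] Op n q where
  toFun Y := ∑ i, kmsInner ρ (B i) Y • B i
  map_add' X Y := by
    simp [kmsInner_add_right, add_smul, Finset.sum_add_distrib]
  map_smul' c X := by
    simp [kmsInner_smul_right, Finset.smul_sum, smul_smul]

theorem kmsExpansion_apply {n q : ℕ} {ι : Type*} [Fintype ι] (ρ : Op n q) (B : ι → Op n q)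
    (Y : Op n q) : kmsExpansion ρ B Y = ∑ i, kmsInner ρ (B i) Y • B i := rfl

theorem kmsInner_conj_symm {n q : ℕ} (ρ X Y : Op n q) :
    star (kmsInner ρ Y X) = kmsInner ρ X Y := by
  have hs : (CFC.sqrt ρ)ᴴ = CFC.sqrt ρ :=
    (Matrix.nonneg_iff_posSemidef.mp (CFC.sqrt_nonneg ρ)).isHermitian
  rw [kmsInner, kmsInner, ← Matrix.trace_conjTranspose]
  simp only [Matrix.conjTranspose_mul, Matrix.conjTranspose_conjTranspose, hs]
  rw [Matrix.trace_mul_comm]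
  simp only [Matrix.mul_assoc]

theorem kmsInner_self_eq {n q : ℕ} (ρ X : Op n q) :
    kmsInner ρ X X = ((CFC.sqrt (CFC.sqrt ρ) * X * CFC.sqrt (CFC.sqrt ρ))ᴴ *
      (CFC.sqrt (CFC.sqrt ρ) * X * CFC.sqrt (CFC.sqrt ρ))).trace := by
  have hr : (CFC.sqrt (CFC.sqrt ρ))ᴴ = CFC.sqrt (CFC.sqrt ρ) :=
    (Matrix.nonneg_iff_posSemidef.mp (CFC.sqrt_nonneg _)).isHermitian
  have hrr : CFC.sqrt (CFC.sqrt ρ) * CFC.sqrt (CFC.sqrt ρ) = CFC.sqrt ρ :=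
    CFC.sqrt_mul_sqrt_self _ (CFC.sqrt_nonneg ρ)
  set r := CFC.sqrt (CFC.sqrt ρ) with hrdef
  rw [kmsInner, ← hrr]
  simp only [Matrix.conjTranspose_mul, hr]
  calc (Xᴴ * (r * r) * X * (r * r)).trace
      = (Xᴴ * (r * r) * X * r * r).trace := by simp only [Matrix.mul_assoc]
    _ = (r * (Xᴴ * (r * r) * X * r)).trace := Matrix.trace_mul_comm _ _
    _ = _ := by simp only [Matrix.mul_assoc]

theorem kmsInner_self_nonneg {n q : ℕ} (ρ X : Op n q) : 0 ≤ (kmsInner ρ X X).re := by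
  rw [kmsInner_self_eq]
  exact (Complex.nonneg_iff.mp (Matrix.posSemidef_conjTranspose_mul_self _).trace_nonneg).1

theorem kmsInner_definite {n q : ℕ} {ρ : Op n q} (hρ : ρ.PosDef) (X : Op n q)
    (h : kmsInner ρ X X = 0) : X = 0 := by
  have hu : IsUnit (CFC.sqrt (CFC.sqrt ρ)) := by
    rw [CFC.isUnit_sqrt_iff _ (CFC.sqrt_nonneg ρ),
      CFC.isUnit_sqrt_iff _ (Matrix.nonneg_iff_posSemidef.mpr hρ.posSemidef)]
    exact hρ.isUnit
  rw [kmsInner_self_eq, Matrix.trace_conjTranspose_mul_self_eq_zero_iff] at h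
  rw [hu.mul_left_eq_zero] at h
  rwa [hu.mul_right_eq_zero] at h

theorem exists_orthonormal_of_core {V : Type*} [AddCommGroup V] [Module ℂ V]
    [FiniteDimensional ℂ V] (c : InnerProductSpace.Core ℂ V) :
    ∃ b : Fin (Module.finrank ℂ V) → V,
      (∀ i j, c.inner (b i) (b j) = if i = j then 1 else 0) ∧
        Submodule.span ℂ (Set.range b) = ⊤ := by
  let _ : NormedAddCommGroup V := c.toNormedAddCommGroup
  let _ : InnerProductSpace ℂ V := InnerProductSpace.ofCore c.toCore
  refine ⟨stdOrthonormalBasis ℂ V, ?_, ?_⟩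
  · exact orthonormal_iff_ite.mp (stdOrthonormalBasis ℂ V).orthonormal
  · have := (stdOrthonormalBasis ℂ V).toBasis.span_eq
    rwa [OrthonormalBasis.coe_toBasis] at this

/-- For a full-rank `ρ`, every `𝓑(𝓗_S)` has a KMS-orthonormal basis. -/
theorem exists_isKMSOrthonormalBasis {n q : ℕ} {ρ : Op n q} (hρ : ρ.PosDef)
    (S : Finset (Fin n)) :
    ∃ B : Fin (Module.finrank ℂ (localOps q S)) → Op n q, IsKMSOrthonormalBasis ρ S B := by
  obtain ⟨b, hb, hspan⟩ := exists_orthonormal_of_core (V := localOps q S)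
    { inner := fun X Y => kmsInner ρ X Y
      conj_inner_symm := fun X Y => kmsInner_conj_symm ρ X Y
      re_inner_nonneg := fun X => kmsInner_self_nonneg ρ X
      add_left := fun X Y Z => by
        simp [kmsInner, Matrix.add_mul]
      smul_left := fun X Y r => by
        simp [kmsInner]
      definite := fun X h => Subtype.ext (kmsInner_definite hρ X h) }
  refine ⟨fun i => b i, ⟨hb, ?_⟩⟩
  have h := congrArg (Submodule.map (localOps q S).subtype) hspan
  rw [Submodule.map_span, ← Set.range_comp, Submodule.map_top, Submodule.range_subtype] at h
  exact h

/-- The spectral conditional expectation `Ẽ_A[Y] = ∑ᵢ ⟨Bᵢ, Y⟩_ρ Bᵢ` of a full-rank state `ρ`,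
where `(Bᵢ)` is a KMS-orthonormal basis of the operators supported on the complement of `A`. Any
basis gives the same map: see `spectralCE_eq_kmsExpansion`. -/
noncomputable def spectralCE {n q : ℕ} (ρ : Op n q) (hρ : ρ.PosDef) (A : Finset (Fin n)) :
    Op n q →ₗ[ℂ] Op n q :=
  kmsExpansion ρ (exists_isKMSOrthonormalBasis hρ Aᶜ).choose

theorem IsKMSOrthonormalBasis.expansion_mem {n q : ℕ} {ι : Type*} [Fintype ι] [DecidableEq ι]
    {ρ : Op n q} {S : Finset (Fin n)} {B : ι → Op n q} (hB : IsKMSOrthonormalBasis ρ S B)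
    (Y : Op n q) : kmsExpansion ρ B Y ∈ localOps q S := by
  rw [← hB.span_eq]
  exact Submodule.sum_mem _ fun i _ =>
    Submodule.smul_mem _ _ (Submodule.subset_span ⟨i, rfl⟩)

theorem IsKMSOrthonormalBasis.expansion_eq_self {n q : ℕ} {ι : Type*} [Fintype ι]
    [DecidableEq ι] {ρ : Op n q} {S : Finset (Fin n)} {B : ι → Op n q}
    (hB : IsKMSOrthonormalBasis ρ S B) {Y : Op n q} (hY : Y ∈ localOps q S) :
    kmsExpansion ρ B Y = Y := by
  rw [← hB.span_eq] at hY
  have h : Set.EqOn (kmsExpansion ρ B) (LinearMap.id : Op n q →ₗ[ℂ] Op n q) (Set.range B) := by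
    rintro _ ⟨j, rfl⟩
    simp [kmsExpansion, hB.orthonormal]
  exact LinearMap.eqOn_span h hY

theorem IsKMSOrthonormalBasis.inner_expansion {n q : ℕ} {ι : Type*} [Fintype ι]
    [DecidableEq ι] {ρ : Op n q} {S : Finset (Fin n)} {B : ι → Op n q}
    (hB : IsKMSOrthonormalBasis ρ S B) (j : ι) (Y : Op n q) :
    kmsInner ρ (B j) (kmsExpansion ρ B Y) = kmsInner ρ (B j) Y := by
  have hsum : ∀ (s : Finset ι) (f : ι → Op n q),
      kmsInner ρ (B j) (∑ i ∈ s, f i) = ∑ i ∈ s, kmsInner ρ (B j) (f i) := fun s f => by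
    simp [kmsInner, Matrix.mul_sum, Matrix.sum_mul, Matrix.trace_sum]
  simp [kmsExpansion, hsum, kmsInner_smul_right, hB.orthonormal]

/-- The spectral conditional expectation does not depend on the choice of the basis. -/
theorem spectralCE_eq_kmsExpansion {n q : ℕ} {ι : Type*} [Fintype ι] [DecidableEq ι]
    {ρ : Op n q} (hρ : ρ.PosDef) {A : Finset (Fin n)} {B : ι → Op n q}
    (hB : IsKMSOrthonormalBasis ρ Aᶜ B) : spectralCE ρ hρ A = kmsExpansion ρ B := by
  have hC := (exists_isKMSOrthonormalBasis hρ Aᶜ).choose_spec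
  refine LinearMap.ext fun Y => ?_
  change kmsExpansion ρ _ Y = _
  conv_rhs => rw [← hC.expansion_eq_self (hB.expansion_mem Y)]
  have key : ∀ j, kmsInner ρ ((exists_isKMSOrthonormalBasis hρ Aᶜ).choose j)
      (kmsExpansion ρ B Y) =
        kmsInner ρ ((exists_isKMSOrthonormalBasis hρ Aᶜ).choose j) Y := by
    intro j
    have hspan : ∀ Z ∈ Submodule.span ℂ (Set.range B),
        kmsInner ρ Z (kmsExpansion ρ B Y) = kmsInner ρ Z Y := by
      intro Z hZ
      induction hZ using Submodule.span_induction with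
      | mem x hx => obtain ⟨i, rfl⟩ := hx; exact hB.inner_expansion i Y
      | zero => simp [kmsInner]
      | add x y _ _ hx hy =>
        have h1 : ∀ W, kmsInner ρ (x + y) W = kmsInner ρ x W + kmsInner ρ y W := fun W => by
          simp [kmsInner, Matrix.add_mul]
        rw [h1, h1, hx, hy]
      | smul a x _ hx =>
        have h1 : ∀ W, kmsInner ρ (a • x) W = star a * kmsInner ρ x W := fun W => by
          simp [kmsInner]
        rw [h1, h1, hx]
    refine hspan _ ?_
    have hj : (exists_isKMSOrthonormalBasis hρ Aᶜ).choose j ∈ Submodule.span ℂ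
        (Set.range (exists_isKMSOrthonormalBasis hρ Aᶜ).choose) :=
      Submodule.subset_span ⟨j, rfl⟩
    exact (hC.span_eq.trans hB.span_eq.symm).le hj
  rw [kmsExpansion_apply, kmsExpansion_apply]
  exact Finset.sum_congr rfl fun j _ => by rw [key j]

namespace ChainHamiltonian

variable {n q : ℕ}

/-- The Hamiltonian `H = ∑_b H_{b,b+1}`. -/
noncomputable def total (H : ChainHamiltonian n q) : Op n q := ∑ b, H.link b

/-- The restriction `H^R` to a set of sites `R`, an operator on the whole chain: only the links
with both ends in `R` are kept. -/
noncomputable def restrict (H : ChainHamiltonian n q) (R : Finset (Fin n)) :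
    ChainHamiltonian n q where
  link b := if leftSite b ∈ R ∧ rightSite b ∈ R then H.link b else 0
  isHermitian_link b := by
    split_ifs
    · exact H.isHermitian_link b
    · exact Matrix.isHermitian_zero
  link_mem b := by
    split_ifs
    · exact H.link_mem b
    · exact Submodule.zero_mem _
  norm_link_le b := by
    split_ifs
    · exact H.norm_link_le b
    · simp

/-- The Gibbs state `e^{-βH} / Tr[e^{-βH}]`. -/
noncomputable def gibbs (H : ChainHamiltonian n q) (β : ℝ) : Op n q :=
  (NormedSpace.exp ((-β) • H.total)).trace⁻¹ • NormedSpace.exp ((-β) • H.total)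

theorem posDef_exp {m : Type*} [Fintype m] [DecidableEq m] {K : Matrix m m ℂ}
    (hK : K.IsHermitian) : (NormedSpace.exp K).PosDef := by
  have h2 : ((2⁻¹ : ℝ) • K).IsHermitian := by
    simp [Matrix.IsHermitian, Matrix.conjTranspose_smul, hK.eq]
  have hexp : NormedSpace.exp K =
      (NormedSpace.exp ((2⁻¹ : ℝ) • K))ᴴ * NormedSpace.exp ((2⁻¹ : ℝ) • K) := by
    rw [h2.exp.eq, ← Matrix.exp_add_of_commute _ _ (Commute.refl _), ← add_smul]
    norm_num
  have hpsd : (NormedSpace.exp K).PosSemidef := by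
    rw [hexp]
    exact Matrix.posSemidef_conjTranspose_mul_self _
  exact hpsd.posDef_iff_isUnit.mpr (Matrix.isUnit_exp K)

theorem gibbs_posDef (H : ChainHamiltonian n q) (β : ℝ) : (H.gibbs β).PosDef := by
  have hH : H.total.IsHermitian := by
    simp only [total, Matrix.IsHermitian, Matrix.conjTranspose_sum]
    exact Finset.sum_congr rfl fun b _ => H.isHermitian_link b
  have hK : ((-β) • H.total).IsHermitian := by
    simp [Matrix.IsHermitian, Matrix.conjTranspose_smul, hH.eq]
  have hp := posDef_exp hK
  exact hp.smul (inv_pos.mpr hp.trace_pos)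

/-- The spectral conditional expectation `Ẽ_A` defined with respect to the Hamiltonian `H`, that
is, with respect to its Gibbs state. -/
noncomputable def spectralCE (H : ChainHamiltonian n q) (β : ℝ) (A : Finset (Fin n)) :
    Op n q →ₗ[ℂ] Op n q :=
  _root_.spectralCE (H.gibbs β) (H.gibbs_posDef β) A

end ChainHamiltonian

/-- The distance between two sets of sites: the least `|i - j|` with `i ∈ A` and `j ∈ B`. It is
`⊤` if one of the sets is empty. -/
noncomputable def siteDist {n : ℕ} (A B : Finset (Fin n)) : ℕ∞ :=
  ⨅ i ∈ A, ⨅ j ∈ B, ((Nat.dist i j : ℕ) : ℕ∞)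

/-- `|∂R|`: the number of end-points at which `R` is cut off from the rest of the chain, counted
by the links with exactly one end in `R`. -/
def numEndpoints {n : ℕ} (R : Finset (Fin n)) : ℕ :=
  (Finset.univ.filter fun b : Fin (n - 1) => ¬(leftSite b ∈ R ↔ rightSite b ∈ R)).card

/-!
Put `u = β / 4`. Let `V` be the sum of the links across the end-points of `R`, let `K = H - V`, and
let `m = |∂R|` be the number of terms of `V`. Since `K` is the sum of `H^R` and of a term that
commutes with it and is supported on the complement of `R`, hence of `A`, the conditional
expectation of `H^R` is also the orthogonal projection, for the weight `e^{-βK}`, onto the operators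
supported on the complement of `A` (`trace_eq_zero_of_weight_mul`). So two orthogonal projections
onto the same space are to be compared, for the weights `e^{-βH}` and `e^{-βK}`.

If `T` is the difference of the two projections of `Y` and `W` is the part of `Y` orthogonal to the
space for `K`, then `⟨T, T⟩ = ⟨T, W⟩` in the inner product of `H`. Relative to the weight of `K`, the
right-hand side is `⟨T, G W G†⟩` with the relative weight `G = e^{uK} e^{-2uH} e^{uK}`, which is
`e^{uK} D e^{-uK}` for `D = e^{-2uH} e^{2uK}`. If `D'` is supported on the complement of `A`, then `G' = e^{uK} D' e^{-uK}` gives `⟨T, G' W G'†⟩ = 0`. Therefore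
the difference of the projections is controlled by `‖G - G'‖` and by the equivalence of the two norms
(`hsNorm_sq_le_of_relative_weight`, `ChainHamiltonian.kmsSuperNorm_spectralCE_sub_le`).

For `D'` one takes `e^{-2uH'} e^{2uK'}`, where `H'` and `K'` are `H` and `K` without the links that touch
`A`. In the interaction picture both `G` and `G'` solve linear differential equations, whose coefficients are
the evolutions of `V` in imaginary time under `K` and `K'` (`norm_interaction_sub_le`). It remains to
see that the evolution of a single link term is bounded independently of the length of the chain, and
that it hardly depends on the links at distance `r`, even after a further evolution.

Here the chain is grouped into shells of links at equal distance from the given link. A shell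
commutes with the operator evolved under the shells at least two steps further in. By
Duhamel's formula, switching on the shells one by one therefore gives nested integrals, whose
`i`-th term is of order `c^i / i!` (`IsShellSeq.norm_expConj_add_succ_sub_le`). The sum over `i` bounds
the evolution, and its tail, of order `c^r / r!`, is the source of the factor `exp(-c₃ ℓ log ℓ)`
(`IsShellSeq.norm_expConj_tail_le`, `evolTail_le`). The further evolution costs only a factor
exponential in `i`, which changes `c`. The factor `c₁ ^ |∂R|` collects the exponentials of the norm of
`V` and its evolutions; the factor `exp(c₂ |A|)` is only used as an upper bound for `1`.
-/

/-! ### Exponentials in a Banach algebra -/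

section BanachAlgebra

open NormedSpace

/-- Grönwall's inequality for a linear differential inequality with constant coefficient. -/
theorem norm_le_mul_exp_of_hasDerivAt {E : Type*} [NormedAddCommGroup E] [NormedSpace ℝ E]
    {f f' : ℝ → E} {K δ s : ℝ} (hs : 0 ≤ s)
    (hf : ∀ t, HasDerivAt f (f' t) t) (h0 : ‖f 0‖ ≤ δ)
    (hK : ∀ t ∈ Set.Icc 0 s, ‖f' t‖ ≤ K * ‖f t‖) : ‖f s‖ ≤ δ * Real.exp (K * s) := by
  have h := norm_le_gronwallBound_of_norm_deriv_right_le (f := f) (f' := f') (δ := δ) (K := K)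
    (ε := 0) (a := 0) (b := s) (fun t _ => (hf t).continuousAt.continuousWithinAt)
    (fun t _ => (hf t).hasDerivWithinAt) h0
    (fun t ht => by simpa using hK t (Set.Ico_subset_Icc_self ht)) s ⟨hs, le_rfl⟩
  simpa [gronwallBound_ε0] using h

variable {𝔸 : Type*} [NormedRing 𝔸]

/-- The evolution `e^K x e^{-K}` in imaginary time. -/
noncomputable def expConj (K x : 𝔸) : 𝔸 := exp K * x * exp (-K)

theorem expConj_zero_right (K : 𝔸) : expConj K 0 = 0 := by simp [expConj]

theorem expConj_zero (x : 𝔸) : expConj 0 x = x := by simp [expConj, exp_zero]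

theorem expConj_sub (K x y : 𝔸) : expConj K (x - y) = expConj K x - expConj K y := by
  simp [expConj, mul_sub, sub_mul]

theorem expConj_sum {ι : Type*} (K : 𝔸) (s : Finset ι) (f : ι → 𝔸) :
    expConj K (∑ i ∈ s, f i) = ∑ i ∈ s, expConj K (f i) := by
  simp [expConj, Finset.mul_sum, Finset.sum_mul]

theorem commute_expConj {a K x : 𝔸} (hK : Commute a K) (hx : Commute a x) :
    Commute a (expConj K x) :=
  (hK.exp_right.mul_right hx).mul_right hK.neg_right.exp_right

variable [NormedAlgebra ℝ 𝔸] [CompleteSpace 𝔸]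

theorem exp_add_of_commute_real {x y : 𝔸} (h : Commute x y) : exp (x + y) = exp x * exp y :=
  letI : NormedAlgebra ℚ 𝔸 := NormedAlgebra.restrictScalars ℚ ℝ 𝔸
  exp_add_of_commute h

theorem exp_mul_exp_neg (x : 𝔸) : exp x * exp (-x) = 1 := by
  rw [← exp_add_of_commute_real (Commute.neg_right rfl), add_neg_cancel, exp_zero]

theorem exp_neg_mul_exp (x : 𝔸) : exp (-x) * exp x = 1 := by
  rw [← exp_add_of_commute_real (Commute.neg_left rfl), neg_add_cancel, exp_zero]

theorem norm_exp_le_exp_norm [NormOneClass 𝔸] (a : 𝔸) : ‖exp a‖ ≤ Real.exp ‖a‖ := by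
  have h := norm_le_mul_exp_of_hasDerivAt (f := fun t : ℝ => exp (t • a))
    (f' := fun t : ℝ => a * exp (t • a)) (K := ‖a‖) (δ := 1) zero_le_one
    (fun t => hasDerivAt_exp_smul_const' a t) (by simp [exp_zero]) (fun t _ => norm_mul_le _ _)
  simpa using h

theorem expConj_one (K : 𝔸) : expConj K 1 = 1 := by simp [expConj, exp_mul_exp_neg]

theorem expConj_mul (K x y : 𝔸) : expConj K (x * y) = expConj K x * expConj K y := by
  calc expConj K (x * y) = exp K * x * 1 * y * exp (-K) := by simp [expConj, mul_assoc]
    _ = _ := by rw [← exp_neg_mul_exp K]; simp only [expConj, mul_assoc]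

theorem expConj_expConj {K L : 𝔸} (h : Commute K L) (x : 𝔸) :
    expConj K (expConj L x) = expConj (K + L) x := by
  have h' : Commute (-L) (-K) := h.symm.neg_left.neg_right
  rw [expConj, expConj, expConj, exp_add_of_commute_real h, neg_add_rev,
    exp_add_of_commute_real h']
  simp only [mul_assoc]

theorem norm_expConj_le [NormOneClass 𝔸] {K : 𝔸} {k : ℝ} (hK : ‖K‖ ≤ k) (x : 𝔸) :
    ‖expConj K x‖ ≤ Real.exp (2 * k) * ‖x‖ := by
  have h1 : ‖exp K‖ ≤ Real.exp k := (norm_exp_le_exp_norm K).trans (Real.exp_le_exp.mpr hK)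
  have h2 : ‖exp (-K)‖ ≤ Real.exp k :=
    (norm_exp_le_exp_norm _).trans (Real.exp_le_exp.mpr (by rwa [norm_neg]))
  calc ‖expConj K x‖ ≤ ‖exp K‖ * ‖x‖ * ‖exp (-K)‖ := by
        unfold expConj
        exact (norm_mul_le _ _).trans (by gcongr; exact norm_mul_le _ _)
    _ ≤ Real.exp k * ‖x‖ * Real.exp k := by gcongr
    _ = _ := by rw [two_mul, Real.exp_add]; ring

theorem hasDerivAt_exp_neg_smul (K : 𝔸) (t : ℝ) :
    HasDerivAt (fun t : ℝ => exp (-(t • K))) (-(exp (-(t • K)) * K)) t := by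
  have h := hasDerivAt_exp_smul_const (-K) t
  simpa using h

theorem hasDerivAt_expConj (K x : 𝔸) (t : ℝ) :
    HasDerivAt (fun t : ℝ => expConj (t • K) x)
      (K * expConj (t • K) x - expConj (t • K) x * K) t := by
  have h := ((hasDerivAt_exp_smul_const' K t).mul_const x).mul (hasDerivAt_exp_neg_smul K t)
  refine h.congr_deriv ?_
  simp only [expConj, mul_neg, mul_assoc, sub_eq_add_neg]

/-- The derivative of the interpolation, between the evolutions with `K'` and with `K` up to the same
time `s`, that evolves with `K` up to time `t` and with `K'` from then on. -/
theorem hasDerivAt_expConj_interpolation (K K' x : 𝔸) (s t : ℝ) :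
    HasDerivAt (fun t : ℝ => expConj ((s - t) • K') (expConj (t • K) x))
      (-expConj ((s - t) • K')
        ((K' - K) * expConj (t • K) x - expConj (t • K) x * (K' - K))) t := by
  have hst : HasDerivAt (fun t : ℝ => s - t) (-1) t := by
    simpa using (hasDerivAt_id t).const_sub s
  have h1 : HasDerivAt (fun t : ℝ => exp ((s - t) • K')) (-(exp ((s - t) • K') * K')) t := by
    have := (hasDerivAt_exp_smul_const K' (s - t)).scomp t hst
    simpa [Function.comp_def] using this
  have h2 : HasDerivAt (fun t : ℝ => exp (-((s - t) • K')))
      (K' * exp (-((s - t) • K'))) t := by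
    have := (hasDerivAt_exp_smul_const' (-K') (s - t)).scomp t hst
    simpa [Function.comp_def] using this
  have h := (h1.mul (hasDerivAt_expConj K x t)).mul h2
  refine h.congr_deriv ?_
  simp only [Pi.mul_apply, expConj]
  noncomm_ring

end BanachAlgebra

/-! ### Locality of the evolution of a chain in imaginary time -/

section Shells

open NormedSpace

/-- A bound for the growth of an operator of range `p` under the evolution up to imaginary
time `s` of a chain. -/
noncomputable def evolBound (p : ℕ) (s : ℝ) : ℝ :=
  Real.exp (4 * p * s) * Real.exp (4 * s * Real.exp (4 * s))

theorem evolBound_nonneg (p : ℕ) (s : ℝ) : 0 ≤ evolBound p s := by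
  unfold evolBound; positivity

theorem evolBound_mono (p : ℕ) {s t : ℝ} (hs : 0 ≤ s) (h : s ≤ t) :
    evolBound p s ≤ evolBound p t := by
  have : 0 ≤ t := hs.trans h
  unfold evolBound
  gcongr

/-- A sequence of operators of norm at most `2` in which only neighbours fail to commute. In a
chain, `g j` is the sum of the (at most two) links at distance `j` from a given link. -/
structure IsShellSeq {𝔸 : Type*} [NormedRing 𝔸] (g : ℕ → 𝔸) : Prop where
  norm_le : ∀ j, ‖g j‖ ≤ 2
  commute : ∀ i j, i + 2 ≤ j → Commute (g i) (g j)

/-- The sum of the first `k` shells. -/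
def shellSum {𝔸 : Type*} [AddCommMonoid 𝔸] (g : ℕ → 𝔸) (k : ℕ) : 𝔸 :=
  ∑ j ∈ Finset.range k, g j

variable {𝔸 : Type*} [NormedRing 𝔸]

theorem IsShellSeq.neg {g : ℕ → 𝔸} (h : IsShellSeq g) : IsShellSeq (-g) where
  norm_le j := by simpa using h.norm_le j
  commute i j hij := by
    simpa using (h.commute i j hij)

theorem shellSum_neg (g : ℕ → 𝔸) (k : ℕ) : shellSum (-g) k = -shellSum g k := by
  simp [shellSum]

theorem shellSum_succ (g : ℕ → 𝔸) (k : ℕ) : shellSum g (k + 1) = shellSum g k + g k := by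
  simp [shellSum, Finset.sum_range_succ]

theorem commute_shellSum {a : 𝔸} {g : ℕ → 𝔸} {k : ℕ} (h : ∀ j < k, Commute a (g j)) :
    Commute a (shellSum g k) :=
  Commute.sum_right _ _ _ fun j hj => h j (Finset.mem_range.mp hj)

variable [NormedAlgebra ℝ 𝔸]

theorem IsShellSeq.norm_smul_shellSum_le {g : ℕ → 𝔸} (h : IsShellSeq g) (k : ℕ) {s : ℝ}
    (hs : 0 ≤ s) : ‖s • shellSum g k‖ ≤ 2 * k * s := by
  have : ‖shellSum g k‖ ≤ ∑ _j ∈ Finset.range k, (2 : ℝ) :=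
    norm_sum_le_of_le _ fun j _ => h.norm_le j
  rw [norm_smul, Real.norm_of_nonneg hs]
  have h2 : ‖shellSum g k‖ ≤ 2 * k := by simpa [mul_comm] using this
  nlinarith

theorem commute_expConj_shellSum {g : ℕ → 𝔸} {x a : 𝔸} {k : ℕ} (s : ℝ)
    (hx : Commute a x) (hg : ∀ j < k, Commute a (g j)) :
    Commute a (expConj (s • shellSum g k) x) :=
  commute_expConj ((commute_shellSum hg).smul_right s) hx

theorem shellSum_telescope (g : ℕ → 𝔸) (x : 𝔸) (s : ℝ) (p r m : ℕ) :
    expConj (s • shellSum g (p + r + m)) x - expConj (s • shellSum g (p + r)) x =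
      ∑ i ∈ Finset.range m, (expConj (s • shellSum g (p + (r + i) + 1)) x -
        expConj (s • shellSum g (p + (r + i))) x) := by
  have := Finset.sum_range_sub (fun i => expConj (s • shellSum g (p + r + i)) x) m
  simpa only [add_assoc, add_zero] using this.symm

variable [CompleteSpace 𝔸]

variable [NormOneClass 𝔸]

theorem IsShellSeq.norm_expConj_le {g : ℕ → 𝔸} (h : IsShellSeq g) (k : ℕ) {s : ℝ}
    (hs : 0 ≤ s) (x : 𝔸) :
    ‖expConj (s • shellSum g k) x‖ ≤ Real.exp (4 * k * s) * ‖x‖ := by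
  have := _root_.norm_expConj_le (h.norm_smul_shellSum_le k hs) x
  rwa [show 2 * (2 * (k : ℝ) * s) = 4 * k * s by ring] at this

/-- One step of the growth estimate: switching on the `k`-th shell changes the evolved operator
by as much as that shell fails to commute with it. -/
theorem IsShellSeq.norm_expConj_succ_sub_le {g : ℕ → 𝔸} (h : IsShellSeq g) (k i : ℕ)
    {s M : ℝ} (hs : 0 ≤ s) (hM0 : 0 ≤ M) (x : 𝔸)
    (hM : ∀ t ∈ Set.Icc 0 s, ‖g k * expConj (t • shellSum g k) x -
      expConj (t • shellSum g k) x * g k‖ ≤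
        4 * (M * Real.exp (4 * k * t) * ((4 * t) ^ i / i.factorial))) :
    ‖expConj (s • shellSum g (k + 1)) x - expConj (s • shellSum g k) x‖ ≤
      M * Real.exp (4 * (k + 1 : ℕ) * s) * ((4 * s) ^ (i + 1) / (i + 1).factorial) := by
  set E := M * Real.exp (4 * (k + 1 : ℕ) * s) with hE
  -- The interpolation between the two evolutions, up to the fixed time `s`. Evolving from `t` to
  -- `s` with the larger sum costs a factor `exp (4 * (k + 1) * (s - t))`.
  set φ : ℝ → 𝔸 := fun t =>
    expConj ((s - t) • shellSum g (k + 1)) (expConj (t • shellSum g k) x) with hφ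
  have hB : ∀ t : ℝ, HasDerivAt (fun t : ℝ => E * ((4 * t) ^ (i + 1) / (i + 1).factorial))
      (E * (4 * ((4 * t) ^ i / i.factorial))) t := by
    intro t
    have h1 : HasDerivAt (fun t : ℝ => (4 * t) ^ (i + 1)) (((i + 1 : ℕ) : ℝ) * (4 * t) ^ i * 4) t := by
      have := ((hasDerivAt_id t).const_mul (4 : ℝ)).pow (i + 1)
      exact this.congr_deriv (by simp)
    refine ((h1.div_const _).const_mul E).congr_deriv ?_
    rw [Nat.factorial_succ]
    push_cast
    have : (i.factorial : ℝ) ≠ 0 := by positivity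
    have : (i + 1 : ℝ) ≠ 0 := by positivity
    field_simp
  have hd : ∀ t, HasDerivAt (fun t => φ t - φ 0) _ t := fun t =>
    (hasDerivAt_expConj_interpolation (shellSum g k) (shellSum g (k + 1)) x s t).sub_const _
  have key := image_norm_le_of_norm_deriv_right_le_deriv_boundary (a := 0) (b := s)
    (f := fun t => φ t - φ 0)
    (fun t _ => (hd t).continuousAt.continuousWithinAt) (fun t _ => (hd t).hasDerivWithinAt)
    (B := fun t : ℝ => E * ((4 * t) ^ (i + 1) / (i + 1).factorial)) (by simp) hB
    (fun t ht => by
      rw [norm_neg, shellSum_succ, add_sub_cancel_left, ← shellSum_succ]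
      refine (h.norm_expConj_le (k + 1) (sub_nonneg.mpr ht.2.le) _).trans ?_
      refine (mul_le_mul_of_nonneg_left (hM t (Set.Ico_subset_Icc_self ht))
        (Real.exp_pos _).le).trans ?_
      have h0 : 0 ≤ M * ((4 * t) ^ i / i.factorial) :=
        mul_nonneg hM0 (div_nonneg (pow_nonneg (by linarith [ht.1]) _) (by positivity))
      have h1 : Real.exp (4 * (k + 1 : ℕ) * (s - t)) * Real.exp (4 * k * t) ≤
          Real.exp (4 * (k + 1 : ℕ) * s) := by
        rw [← Real.exp_add, Real.exp_le_exp]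
        push_cast
        nlinarith [ht.1]
      rw [hE]
      nlinarith [mul_le_mul_of_nonneg_right h1 h0]) ⟨hs, le_rfl⟩
  have e1 : φ s = expConj (s • shellSum g k) x := by simp [hφ, expConj_zero]
  have e2 : φ 0 = expConj (s • shellSum g (k + 1)) x := by simp [hφ, expConj_zero]
  rw [e1, e2, norm_sub_rev] at key
  exact key

/-- The effect of the `(i + 1)`-st shell outside the range of `x` has the size of the `(i + 1)`-st
term of an exponential series: each shell has to be reached through all the previous ones. -/
theorem IsShellSeq.norm_expConj_add_succ_sub_le {g : ℕ → 𝔸} (h : IsShellSeq g) {p : ℕ} {x : 𝔸}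
    (hx : ∀ j, p ≤ j → Commute (g j) x) (i : ℕ) {s : ℝ} (hs : 0 ≤ s) :
    ‖expConj (s • shellSum g (p + i + 1)) x - expConj (s • shellSum g (p + i)) x‖ ≤
      ‖x‖ * Real.exp (4 * (p + i + 1 : ℕ) * s) * ((4 * s) ^ (i + 1) / (i + 1).factorial) := by
  have hcomm : ∀ a y : 𝔸, ‖a‖ ≤ 2 → ‖a * y - y * a‖ ≤ 4 * ‖y‖ := fun a y ha => by
    have h1 := norm_sub_le (a * y) (y * a)
    have h2 := norm_mul_le a y
    have h3 := norm_mul_le y a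
    nlinarith [norm_nonneg y]
  induction i generalizing s with
  | zero =>
    refine h.norm_expConj_succ_sub_le (p + 0) 0 hs (norm_nonneg x) x fun t ht => ?_
    refine (hcomm _ _ (h.norm_le _)).trans ?_
    have := h.norm_expConj_le (p + 0) ht.1 x
    simp only [pow_zero, Nat.factorial_zero, Nat.cast_one, div_one, mul_one]
    linarith
  | succ i ih =>
    refine h.norm_expConj_succ_sub_le (p + (i + 1)) (i + 1) hs (norm_nonneg x) x fun t ht => ?_
    -- The shell commutes with the operator evolved without the shell just before it.
    have hc : Commute (g (p + (i + 1))) (expConj (t • shellSum g (p + i)) x) :=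
      commute_expConj_shellSum t (hx _ (by omega))
        fun j hj => (h.commute j _ (by omega)).symm
    have hrw : g (p + (i + 1)) * expConj (t • shellSum g (p + (i + 1))) x -
        expConj (t • shellSum g (p + (i + 1))) x * g (p + (i + 1)) =
        g (p + (i + 1)) * (expConj (t • shellSum g (p + i + 1)) x -
          expConj (t • shellSum g (p + i)) x) -
        (expConj (t • shellSum g (p + i + 1)) x - expConj (t • shellSum g (p + i)) x) *
          g (p + (i + 1)) := by
      rw [mul_sub, sub_mul, hc.eq, add_assoc]
      abel
    rw [hrw]
    exact (hcomm _ _ (h.norm_le _)).trans (mul_le_mul_of_nonneg_left (ih ht.1) (by norm_num))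

/-- The growth of an operator of range `p` under the evolution of a chain in imaginary time is
bounded independently of the length of the chain. -/
theorem IsShellSeq.norm_expConj_le_evolBound {g : ℕ → 𝔸} (h : IsShellSeq g) {p : ℕ} {x : 𝔸}
    (hx : ∀ j, p ≤ j → Commute (g j) x) (N : ℕ) {s : ℝ} (hs : 0 ≤ s) :
    ‖expConj (s • shellSum g N) x‖ ≤ ‖x‖ * evolBound p s := by
  have hc : 0 ≤ 4 * s * Real.exp (4 * s) := by positivity
  rcases lt_or_ge N p with hN | hN
  · refine (h.norm_expConj_le N hs x).trans ?_
    rw [mul_comm, evolBound]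
    have h1 : Real.exp (4 * N * s) ≤ Real.exp (4 * p * s) := by gcongr
    have h2 := Real.one_le_exp hc
    gcongr
    nlinarith [Real.exp_pos (4 * p * s)]
  obtain ⟨m, rfl⟩ := Nat.exists_eq_add_of_le hN
  have htel := shellSum_telescope g x s p 0 m
  simp only [add_zero, zero_add] at htel
  rw [sub_eq_iff_eq_add] at htel
  have hterm : ∀ i ∈ Finset.range m,
      ‖expConj (s • shellSum g (p + i + 1)) x - expConj (s • shellSum g (p + i)) x‖ ≤
        ‖x‖ * Real.exp (4 * p * s) *
          ((4 * s * Real.exp (4 * s)) ^ (i + 1) / (i + 1).factorial) := fun i _ => by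
    refine (h.norm_expConj_add_succ_sub_le hx i hs).trans (le_of_eq ?_)
    rw [mul_pow (4 * s) (Real.exp _), ← Real.exp_nat_mul]
    have : Real.exp (4 * (p + i + 1 : ℕ) * s) =
        Real.exp (4 * p * s) * Real.exp ((i + 1 : ℕ) * (4 * s)) := by
      rw [← Real.exp_add]; congr 1; push_cast; ring
    rw [this]; ring
  calc ‖expConj (s • shellSum g (p + m)) x‖
      ≤ ∑ i ∈ Finset.range m, ‖x‖ * Real.exp (4 * p * s) *
          ((4 * s * Real.exp (4 * s)) ^ (i + 1) / (i + 1).factorial) +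
          Real.exp (4 * p * s) * ‖x‖ := by
        rw [htel]
        exact (norm_add_le _ _).trans
          (add_le_add (norm_sum_le_of_le _ hterm) (h.norm_expConj_le p hs x))
    _ = ‖x‖ * Real.exp (4 * p * s) *
          ∑ i ∈ Finset.range (m + 1), (4 * s * Real.exp (4 * s)) ^ i / i.factorial := by
        rw [Finset.sum_range_succ', ← Finset.mul_sum]
        simp
        ring
    _ ≤ ‖x‖ * Real.exp (4 * p * s) * Real.exp (4 * s * Real.exp (4 * s)) :=
        mul_le_mul_of_nonneg_left (Real.sum_le_exp_of_nonneg hc _) (by positivity)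
    _ = _ := by rw [evolBound, mul_assoc]

theorem IsShellSeq.norm_expConj_le_evolBound_of_abs_le {g : ℕ → 𝔸} (h : IsShellSeq g) {p : ℕ}
    {x : 𝔸} (hx : ∀ j, p ≤ j → Commute (g j) x) (N : ℕ) {s u : ℝ} (hs : |s| ≤ u) :
    ‖expConj (s • shellSum g N) x‖ ≤ ‖x‖ * evolBound p u := by
  refine le_trans ?_ (mul_le_mul_of_nonneg_left (evolBound_mono p (abs_nonneg s) hs)
    (norm_nonneg x))
  rcases le_total 0 s with h0 | h0
  · rw [abs_of_nonneg h0]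
    exact h.norm_expConj_le_evolBound hx N h0
  · rw [abs_of_nonpos h0]
    have := h.neg.norm_expConj_le_evolBound (x := x) (p := p)
      (fun j hj => by simpa using hx j hj) N (neg_nonneg.mpr h0)
    rwa [shellSum_neg, neg_smul_neg] at this

/-- A bound for the tail of the evolution up to imaginary time `s`, after a further evolution up to time `u`,
of an operator of range `p`, when the shells beyond `p + r` are switched off. -/
noncomputable def evolTail (p : ℕ) (s u : ℝ) (r : ℕ) : ℝ :=
  Real.exp (4 * p * s + 4 * (p + 1) * u) * Real.exp (4 * u * Real.exp (4 * u)) *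
    Real.exp (4 * s * Real.exp (4 * (s + u))) *
      ((4 * s * Real.exp (4 * (s + u))) ^ r / r.factorial)

theorem evolTail_nonneg (p : ℕ) {s : ℝ} (hs : 0 ≤ s) (u : ℝ) (r : ℕ) : 0 ≤ evolTail p s u r := by
  unfold evolTail; positivity

theorem evolTail_mono (p : ℕ) {s t : ℝ} (hs : 0 ≤ s) (h : s ≤ t) (u : ℝ) (r : ℕ) :
    evolTail p s u r ≤ evolTail p t u r := by
  have : 0 ≤ t := hs.trans h
  unfold evolTail
  gcongr

theorem sum_pow_succ_div_factorial_le {c : ℝ} (hc : 0 ≤ c) (r m : ℕ) :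
    ∑ i ∈ Finset.range m, c ^ (r + i + 1) / (r + i + 1).factorial ≤
      c ^ r / r.factorial * Real.exp c := by
  have hterm : ∀ i ∈ Finset.range m, c ^ (r + i + 1) / (r + i + 1).factorial ≤
      c ^ r / r.factorial * (c ^ (i + 1) / (i + 1).factorial) := fun i _ => by
    rw [div_mul_div_comm, ← pow_add, add_assoc]
    gcongr
    exact_mod_cast Nat.le_of_dvd (Nat.factorial_pos _)
      (Nat.factorial_mul_factorial_dvd_factorial_add r (i + 1))
  refine (Finset.sum_le_sum hterm).trans ?_
  rw [← Finset.mul_sum]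
  refine mul_le_mul_of_nonneg_left ?_ (by positivity)
  have := Real.sum_le_exp_of_nonneg hc (m + 1)
  rw [Finset.sum_range_succ'] at this
  simp at this
  linarith

/-- Switching off the shells beyond `p + r` changes the evolution of an operator of range `p` by
a factorially small amount, even after a further evolution. The further evolution costs only a
factor exponential in the range, which the factorial absorbs. -/
theorem IsShellSeq.norm_expConj_tail_le {g g' : ℕ → 𝔸} (h : IsShellSeq g) (h' : IsShellSeq g')
    (hgg' : ∀ i j, i + 2 ≤ j → Commute (g j) (g' i)) {p : ℕ} {x : 𝔸}
    (hx : ∀ j, p ≤ j → Commute (g j) x) (hx' : ∀ j, p ≤ j → Commute (g' j) x)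
    (N r m : ℕ) {s u : ℝ} (hs : 0 ≤ s) (hu : 0 ≤ u) :
    ‖expConj (u • shellSum g N) (expConj (s • shellSum g' (p + r + m)) x -
      expConj (s • shellSum g' (p + r)) x)‖ ≤ ‖x‖ * evolTail p s u r := by
  set c := 4 * s * Real.exp (4 * (s + u)) with hc
  have hc0 : 0 ≤ c := by positivity
  set M := ‖x‖ * Real.exp (4 * p * s + 4 * (p + 1) * u) * Real.exp (4 * u * Real.exp (4 * u))
    with hM
  have hterm : ∀ i ∈ Finset.range m,
      ‖expConj (u • shellSum g N) (expConj (s • shellSum g' (p + (r + i) + 1)) x -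
        expConj (s • shellSum g' (p + (r + i))) x)‖ ≤
          M * (c ^ (r + i + 1) / (r + i + 1).factorial) := fun i _ => by
    have hcomm : ∀ j, p + (r + i) + 2 ≤ j →
        Commute (g j) (expConj (s • shellSum g' (p + (r + i) + 1)) x -
          expConj (s • shellSum g' (p + (r + i))) x) := fun j hj =>
      (commute_expConj_shellSum s (hx j (by omega)) fun k hk => hgg' k j (by omega)).sub_right
        (commute_expConj_shellSum s (hx j (by omega)) fun k hk => hgg' k j (by omega))
    refine (h.norm_expConj_le_evolBound hcomm N hu).trans ?_
    refine (mul_le_mul_of_nonneg_right (h'.norm_expConj_add_succ_sub_le hx' (r + i) hs)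
      (evolBound_nonneg _ _)).trans (le_of_eq ?_)
    rw [hM, hc, evolBound, mul_pow (4 * s) (Real.exp _), ← Real.exp_nat_mul]
    have : Real.exp (4 * (p + (r + i) + 1 : ℕ) * s) *
        Real.exp (4 * (p + (r + i) + 2 : ℕ) * u) =
        Real.exp (4 * p * s + 4 * (p + 1) * u) *
          Real.exp ((r + i + 1 : ℕ) * (4 * (s + u))) := by
      rw [← Real.exp_add, ← Real.exp_add]; congr 1; push_cast; ring
    linear_combination (‖x‖ * ((4 * s) ^ (r + i + 1) / (r + i + 1).factorial) *
      Real.exp (4 * u * Real.exp (4 * u))) * this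
  rw [shellSum_telescope, expConj_sum]
  refine (norm_sum_le_of_le _ hterm).trans ?_
  rw [← Finset.mul_sum]
  refine (mul_le_mul_of_nonneg_left (sum_pow_succ_div_factorial_le hc0 r m)
    (by positivity)).trans (le_of_eq ?_)
  rw [hM, evolTail, ← hc]
  ring

/-- Two chains that agree up to distance `p + r` evolve an operator of range `p` in almost the
same way. -/
theorem IsShellSeq.norm_expConj_sub_le {g g' : ℕ → 𝔸} (h : IsShellSeq g) (h' : IsShellSeq g')
    (hgg' : ∀ i j, i + 2 ≤ j → Commute (g j) (g' i)) {p : ℕ} {x : 𝔸}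
    (hx : ∀ j, p ≤ j → Commute (g j) x) (hx' : ∀ j, p ≤ j → Commute (g' j) x)
    {r : ℕ} (heq : ∀ j < p + r, g j = g' j) {N : ℕ} (hN : p + r ≤ N) {s u : ℝ} (hs : 0 ≤ s)
    (hu : 0 ≤ u) :
    ‖expConj (u • shellSum g N) (expConj (-(s • shellSum g N)) x) -
      expConj (u • shellSum g N) (expConj (-(s • shellSum g' N)) x)‖ ≤
        2 * (‖x‖ * evolTail p s u r) := by
  obtain ⟨m, rfl⟩ := Nat.exists_eq_add_of_le hN
  have h1 := h.norm_expConj_tail_le h.neg (fun i j hij => by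
    simpa using (h.commute i j hij).symm) hx (fun j hj => by simpa using hx j hj)
    (p + r + m) r m hs hu
  have h2 := h.norm_expConj_tail_le h'.neg (fun i j hij => by
    simpa using (hgg' i j hij)) hx (fun j hj => by simpa using hx' j hj)
    (p + r + m) r m hs hu
  have he : shellSum g (p + r) = shellSum g' (p + r) :=
    Finset.sum_congr rfl fun j hj => heq j (Finset.mem_range.mp hj)
  simp only [shellSum_neg, smul_neg, expConj_sub, ← he] at h1 h2
  rw [two_mul]
  refine le_trans (le_of_eq ?_) ((norm_sub_le _ _).trans (add_le_add h1 h2))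
  congr 1
  abel

end Shells

/-! ### Perturbation of exponentials in the interaction picture -/

section Perturbation

open NormedSpace

variable {𝔸 : Type*} [NormedRing 𝔸] [NormedAlgebra ℝ 𝔸]

theorem hasDerivAt_expConj_const {f : ℝ → 𝔸} {f' : 𝔸} {t : ℝ} (L : 𝔸) (h : HasDerivAt f f' t) :
    HasDerivAt (fun t => expConj L (f t)) (expConj L f') t :=
  (h.const_mul (exp L)).mul_const (exp (-L))

variable [CompleteSpace 𝔸]

theorem mul_expConj_eq (L K V a : 𝔸) :
    expConj L (a * exp K) * expConj L (expConj (-K) V) = expConj L (a * V * exp K) := by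
  rw [← expConj_mul]
  congr 1
  calc a * exp K * expConj (-K) V = a * (exp K * exp (-K)) * V * exp K := by
        simp only [expConj, neg_neg, mul_assoc]
    _ = _ := by rw [exp_mul_exp_neg, mul_one]

theorem expConj_mul_eq (L K V a : 𝔸) :
    expConj L (expConj (-K) V) * expConj L (exp (-K) * a) = expConj L (exp (-K) * V * a) := by
  rw [← expConj_mul]
  congr 1
  calc expConj (-K) V * (exp (-K) * a) = exp (-K) * V * (exp K * exp (-K)) * a := by
        simp only [expConj, neg_neg, mul_assoc]
    _ = _ := by rw [exp_mul_exp_neg, mul_one]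

/-- The differential equation of the interaction picture, after conjugation with `e^L`. -/
theorem hasDerivAt_interaction (L K V : 𝔸) (t : ℝ) :
    HasDerivAt (fun t : ℝ => expConj L (exp (-(t • (K + V))) * exp (t • K)))
      (-(expConj L (exp (-(t • (K + V))) * exp (t • K)) *
        expConj L (expConj (-(t • K)) V))) t := by
  have h := hasDerivAt_expConj_const L
    ((hasDerivAt_exp_neg_smul (K + V) t).mul (hasDerivAt_exp_smul_const' K t))
  refine h.congr_deriv ?_
  rw [mul_expConj_eq]
  simp only [expConj]
  noncomm_ring

theorem hasDerivAt_interaction_inv (L K V : 𝔸) (t : ℝ) :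
    HasDerivAt (fun t : ℝ => expConj L (exp (-(t • K)) * exp (t • (K + V))))
      (expConj L (expConj (-(t • K)) V) *
        expConj L (exp (-(t • K)) * exp (t • (K + V)))) t := by
  have h := hasDerivAt_expConj_const L
    ((hasDerivAt_exp_neg_smul K t).mul (hasDerivAt_exp_smul_const' (K + V) t))
  refine h.congr_deriv ?_
  rw [expConj_mul_eq]
  simp only [expConj]
  noncomm_ring

variable [NormOneClass 𝔸]

theorem norm_interaction_le (L K V : 𝔸) {s a : ℝ} (hs : 0 ≤ s)
    (ha : ∀ t ∈ Set.Icc 0 s, ‖expConj L (expConj (-(t • K)) V)‖ ≤ a) :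
    ‖expConj L (exp (-(s • (K + V))) * exp (s • K))‖ ≤ Real.exp (a * s) := by
  have := norm_le_mul_exp_of_hasDerivAt (K := a) (δ := 1) hs (hasDerivAt_interaction L K V)
    (by simp [exp_zero, expConj_one]) (fun t ht => by
      rw [norm_neg, mul_comm a]
      exact (norm_mul_le _ _).trans (mul_le_mul_of_nonneg_left (ha t ht) (norm_nonneg _)))
  simpa using this

theorem norm_interaction_inv_le (L K V : 𝔸) {s a : ℝ} (hs : 0 ≤ s)
    (ha : ∀ t ∈ Set.Icc 0 s, ‖expConj L (expConj (-(t • K)) V)‖ ≤ a) :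
    ‖expConj L (exp (-(s • K)) * exp (s • (K + V)))‖ ≤ Real.exp (a * s) := by
  have := norm_le_mul_exp_of_hasDerivAt (K := a) (δ := 1) hs (hasDerivAt_interaction_inv L K V)
    (by simp [exp_zero, expConj_one]) (fun t ht =>
      (norm_mul_le _ _).trans (mul_le_mul_of_nonneg_right (ha t ht) (norm_nonneg _)))
  simpa using this

/-- If a perturbation `V` evolves in almost the same way under `K` and `K'`, then it changes their
exponentials in almost the same way. -/
theorem norm_interaction_sub_le (L K K' V : 𝔸) {s a ε : ℝ} (hs : 0 ≤ s)
    (ha : ∀ t ∈ Set.Icc 0 s, ‖expConj L (expConj (-(t • K)) V)‖ ≤ a)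
    (hε : ∀ t ∈ Set.Icc 0 s,
      ‖expConj L (expConj (-(t • K)) V) - expConj L (expConj (-(t • K')) V)‖ ≤ ε) :
    ‖expConj L (exp (-(s • (K + V))) * exp (s • K)) -
      expConj L (exp (-(s • (K' + V))) * exp (s • K'))‖ ≤
        ε * s * Real.exp ((3 * a + ε) * s) := by
  have h0 : (0 : ℝ) ∈ Set.Icc 0 s := ⟨le_rfl, hs⟩
  have ha0 : 0 ≤ a := (norm_nonneg _).trans (ha 0 h0)
  have hε0 : 0 ≤ ε := (norm_nonneg _).trans (hε 0 h0)
  -- `X` and `X'` have the coefficients `-A` and `-B`, and `Z` is the inverse of `X`. The estimate is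
  -- that of the derivative `X' * (A - B) * Z` of `X' * Z`.
  set A : ℝ → 𝔸 := fun t => expConj L (expConj (-(t • K)) V) with hA
  set B : ℝ → 𝔸 := fun t => expConj L (expConj (-(t • K')) V) with hB
  set X : ℝ → 𝔸 := fun t => expConj L (exp (-(t • (K + V))) * exp (t • K)) with hX
  set X' : ℝ → 𝔸 := fun t => expConj L (exp (-(t • (K' + V))) * exp (t • K')) with hX'
  set Z : ℝ → 𝔸 := fun t => expConj L (exp (-(t • K)) * exp (t • (K + V))) with hZ
  have hZX : ∀ t, Z t * X t = 1 := fun t => by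
    rw [hZ, hX, ← expConj_mul]
    have : exp (-(t • K)) * exp (t • (K + V)) * (exp (-(t • (K + V))) * exp (t • K)) =
        exp (-(t • K)) * (exp (t • (K + V)) * exp (-(t • (K + V)))) * exp (t • K) := by
      simp only [mul_assoc]
    rw [this, exp_mul_exp_neg, mul_one, exp_neg_mul_exp, expConj_one]
  have hb : ∀ t ∈ Set.Icc 0 s, ‖B t‖ ≤ a + ε := fun t ht => by
    have : B t = A t - (A t - B t) := by abel
    rw [this]
    exact (norm_sub_le _ _).trans (add_le_add (ha t ht) (hε t ht))
  have hd : ∀ t, HasDerivAt (fun t => X' t * Z t) (X' t * (A t - B t) * Z t) t := fun t => by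
    refine ((hasDerivAt_interaction L K' V t).mul
      (hasDerivAt_interaction_inv L K V t)).congr_deriv ?_
    simp only [hX', hA, hB, hZ]
    noncomm_ring
  have hbound : ∀ t ∈ Set.Ico 0 s, ‖X' t * (A t - B t) * Z t‖ ≤
      ε * Real.exp ((2 * a + ε) * s) := fun t ht => by
    have hsub : Set.Icc 0 t ⊆ Set.Icc 0 s := Set.Icc_subset_Icc le_rfl ht.2.le
    have h1 : ‖X' t‖ ≤ Real.exp ((a + ε) * s) :=
      (norm_interaction_le L K' V ht.1 fun r hr => hb r (hsub hr)).trans (by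
        gcongr; exact ht.2.le)
    have h2 : ‖Z t‖ ≤ Real.exp (a * s) :=
      (norm_interaction_inv_le L K V ht.1 fun r hr => ha r (hsub hr)).trans (by
        gcongr; exact ht.2.le)
    calc ‖X' t * (A t - B t) * Z t‖ ≤ ‖X' t‖ * ‖A t - B t‖ * ‖Z t‖ :=
          (norm_mul_le _ _).trans (by gcongr; exact norm_mul_le _ _)
      _ ≤ Real.exp ((a + ε) * s) * ε * Real.exp (a * s) := by
          gcongr
          exact hε t (Set.Ico_subset_Icc_self ht)
      _ = _ := by
          rw [show (2 * a + ε) * s = (a + ε) * s + a * s by ring, Real.exp_add]; ring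
  have key := norm_image_sub_le_of_norm_deriv_le_segment' (f := fun t => X' t * Z t)
    (fun t _ => (hd t).hasDerivWithinAt) hbound s ⟨hs, le_rfl⟩
  have h00 : X' 0 * Z 0 = 1 := by simp [hX', hZ, exp_zero, expConj_one]
  simp only [h00, sub_zero] at key
  have hfact : X s - X' s = -((X' s * Z s - 1) * X s) := by
    rw [sub_mul, mul_assoc, hZX, mul_one, one_mul, neg_sub]
  have hXs : ‖X s‖ ≤ Real.exp (a * s) := norm_interaction_le L K V hs ha
  calc ‖X s - X' s‖ ≤ ‖X' s * Z s - 1‖ * ‖X s‖ := by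
        rw [hfact, norm_neg]; exact norm_mul_le _ _
    _ ≤ (ε * Real.exp ((2 * a + ε) * s) * s) * Real.exp (a * s) := by gcongr
    _ = _ := by
        rw [show (3 * a + ε) * s = (2 * a + ε) * s + a * s by ring, Real.exp_add]; ring

theorem norm_exp_neg_mul_exp_le (K V : 𝔸) {u a : ℝ} (hu : 0 ≤ u)
    (ha : ∀ t : ℝ, |t| ≤ u → ‖expConj (t • K) V‖ ≤ a) :
    ‖exp (-(u • (K + V))) * exp (u • K)‖ ≤ Real.exp (a * u) := by
  have := norm_interaction_le 0 K V hu (a := a) (fun t ht => by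
    rw [expConj_zero, ← neg_smul]
    exact ha _ (by rw [abs_neg, abs_of_nonneg ht.1]; exact ht.2))
  rwa [expConj_zero] at this

theorem norm_exp_neg_mul_exp_inv_le (K V : 𝔸) {u a : ℝ} (hu : 0 ≤ u)
    (ha : ∀ t : ℝ, |t| ≤ u → ‖expConj (t • K) V‖ ≤ a) :
    ‖exp (-(u • K)) * exp (u • (K + V))‖ ≤ Real.exp (a * u) := by
  have := norm_interaction_inv_le 0 K V hu (a := a) (fun t ht => by
    rw [expConj_zero, ← neg_smul]
    exact ha _ (by rw [abs_neg, abs_of_nonneg ht.1]; exact ht.2))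
  rwa [expConj_zero] at this

theorem norm_exp_mul_exp_neg_le (K V : 𝔸) {u a : ℝ} (hu : 0 ≤ u)
    (ha : ∀ t : ℝ, |t| ≤ u → ‖expConj (t • K) V‖ ≤ a) :
    ‖exp (u • (K + V)) * exp (-(u • K))‖ ≤ Real.exp (a * u) := by
  have := norm_exp_neg_mul_exp_le (-K) (-V) hu (a := a) (fun t ht => by
    have := ha (-t) (by rwa [abs_neg])
    rw [smul_neg, ← neg_smul]
    simpa [expConj] using this)
  rwa [← neg_add, smul_neg, neg_neg, smul_neg] at this

end Perturbation

/-! ### Operators supported on a set of sites -/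

section LocalOps

open NormedSpace Kronecker

variable {n q : ℕ}

theorem extendOp_eq_submatrix (S : Finset (Fin n))
    (M : Matrix (S → Fin (2 ^ q)) (S → Fin (2 ^ q)) ℂ) :
    extendOp S M = (M ⊗ₖ (1 : Matrix ({i // i ∉ S} → Fin (2 ^ q)) _ ℂ)).submatrix
      (Equiv.piEquivPiSubtypeProd (· ∈ S) fun _ => Fin (2 ^ q))
      (Equiv.piEquivPiSubtypeProd (· ∈ S) fun _ => Fin (2 ^ q)) := by
  ext x y
  simp [extendOp, Matrix.one_apply, funext_iff]

theorem extendOp_mul (S : Finset (Fin n))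
    (M N : Matrix (S → Fin (2 ^ q)) (S → Fin (2 ^ q)) ℂ) :
    extendOp S (M * N) = extendOp S M * extendOp S N := by
  simp only [extendOp_eq_submatrix]
  rw [Matrix.submatrix_mul_equiv, ← Matrix.mul_kronecker_mul, one_mul]

theorem one_mem_localOps (S : Finset (Fin n)) : (1 : Op n q) ∈ localOps q S :=
  ⟨1, by rw [extendOp_eq_submatrix, Matrix.one_kronecker_one, Matrix.submatrix_one_equiv]⟩

theorem mul_mem_localOps {S : Finset (Fin n)} {X Y : Op n q} (hX : X ∈ localOps q S)
    (hY : Y ∈ localOps q S) : X * Y ∈ localOps q S := by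
  obtain ⟨M, rfl⟩ := hX
  obtain ⟨N, rfl⟩ := hY
  exact ⟨M * N, extendOp_mul S M N⟩

theorem conjTranspose_mem_localOps {S : Finset (Fin n)} {X : Op n q} (hX : X ∈ localOps q S) :
    Xᴴ ∈ localOps q S := by
  obtain ⟨M, rfl⟩ := hX
  refine ⟨Mᴴ, ?_⟩
  ext x y
  simp only [extendOp, LinearMap.coe_mk, AddHom.coe_mk, Matrix.of_apply,
    Matrix.conjTranspose_apply, eq_comm (a := x _)]
  split_ifs <;> simp

theorem localOps_mono {S T : Finset (Fin n)} (h : S ⊆ T) : localOps q S ≤ localOps q T := by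
  rintro _ ⟨M, rfl⟩
  refine ⟨Matrix.of fun a b => if ∀ i : T, (i : Fin n) ∉ S → a i = b i then
    M (fun i => a ⟨i, h i.2⟩) (fun i => b ⟨i, h i.2⟩) else 0, ?_⟩
  ext x y
  simp only [extendOp, LinearMap.coe_mk, AddHom.coe_mk, Matrix.of_apply, ← ite_and]
  refine if_congr ⟨fun hxy i hi => ?_, fun hxy => ⟨fun i hi => ?_, fun i hi => ?_⟩⟩ rfl rfl
  · by_cases hT : i ∈ T
    · exact hxy.2 ⟨i, hT⟩ hi
    · exact hxy.1 i hT
  · exact hxy i fun hS => hi (h hS)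
  · exact hxy i hi

theorem extendOp_mul_extendOp_apply {S T : Finset (Fin n)} (h : Disjoint S T)
    (M : Matrix (S → Fin (2 ^ q)) (S → Fin (2 ^ q)) ℂ)
    (N : Matrix (T → Fin (2 ^ q)) (T → Fin (2 ^ q)) ℂ) (x z : Config n q) :
    (extendOp S M * extendOp T N) x z = if ∀ i, i ∉ S → i ∉ T → x i = z i then
      M (fun i => x i) (fun i => z i) * N (fun i => x i) (fun i => z i) else 0 := by
  have hST : ∀ i, i ∈ S → i ∉ T := fun i hS hT => Finset.disjoint_left.mp h hS hT
  set y₀ : Config n q := fun i => if i ∈ S then z i else x i with hy₀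
  rw [Matrix.mul_apply, Finset.sum_eq_single y₀]
  · have h1 : ∀ i, i ∉ S → x i = y₀ i := fun i hi => by simp [hy₀, hi]
    have h2 : (fun i : S => y₀ i) = fun i : S => z i := by ext i; simp [hy₀]
    have h3 : (fun i : T => y₀ i) = fun i : T => x i := by
      ext i
      have : (i : Fin n) ∉ S := fun hS => hST i hS i.2
      simp [hy₀, this]
    simp only [extendOp, LinearMap.coe_mk, AddHom.coe_mk, Matrix.of_apply]
    rw [if_pos h1, h2, h3, mul_ite, mul_zero]
    refine if_congr ⟨fun hi i hS hT => ?_, fun hi i hT => ?_⟩ rfl rfl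
    · rw [h1 i hS, hi i hT]
    · by_cases hS : i ∈ S
      · simp [hy₀, hS]
      · simp [hy₀, hS, hi i hS hT]
  · intro y _ hy
    simp only [extendOp, LinearMap.coe_mk, AddHom.coe_mk, Matrix.of_apply]
    split_ifs with h1 h2
    · refine absurd ?_ hy
      ext i
      by_cases hS : i ∈ S
      · simp [hy₀, hS, h2 i (hST i hS)]
      · simp [hy₀, hS, h1 i hS]
    all_goals simp
  · simp

theorem commute_of_mem_localOps {S T : Finset (Fin n)} (h : Disjoint S T) {X Y : Op n q}
    (hX : X ∈ localOps q S) (hY : Y ∈ localOps q T) : Commute X Y := by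
  obtain ⟨M, rfl⟩ := hX
  obtain ⟨N, rfl⟩ := hY
  ext x z
  rw [extendOp_mul_extendOp_apply h, extendOp_mul_extendOp_apply h.symm]
  exact if_congr ⟨fun H i hT hS => H i hS hT, fun H i hS hT => H i hT hS⟩ (mul_comm _ _) rfl

theorem exp_mem_localOps {S : Finset (Fin n)} {X : Op n q} (hX : X ∈ localOps q S) :
    exp X ∈ localOps q S := by
  let B : Subalgebra ℂ (Op n q) := (localOps q S).toSubalgebra (one_mem_localOps S)
    fun _ _ => mul_mem_localOps
  have hB : IsClosed (B : Set (Op n q)) := (localOps q S).closed_of_finiteDimensional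
  exact NormedSpace.exp_mem (R := ℂ) (s := B) hB hX

end LocalOps

/-! ### The Hilbert-Schmidt norm -/

section HilbertSchmidt

variable {m : Type*} [Fintype m]

/-- The Hilbert-Schmidt norm of a matrix, as the Euclidean norm of the vector of its entries. -/
noncomputable def hsNorm (X : Matrix m m ℂ) : ℝ :=
  ‖(WithLp.toLp 2 fun p : m × m => X p.1 p.2 : EuclideanSpace ℂ (m × m))‖

theorem hsNorm_nonneg (X : Matrix m m ℂ) : 0 ≤ hsNorm X := norm_nonneg _

theorem hsNorm_add_le (X Y : Matrix m m ℂ) : hsNorm (X + Y) ≤ hsNorm X + hsNorm Y :=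
  norm_add_le (WithLp.toLp 2 fun p : m × m => X p.1 p.2 : EuclideanSpace ℂ (m × m))
    (WithLp.toLp 2 fun p : m × m => Y p.1 p.2)

theorem trace_conjTranspose_mul_eq_inner (X Y : Matrix m m ℂ) :
    (Xᴴ * Y).trace = inner ℂ
      (WithLp.toLp 2 fun p : m × m => X p.1 p.2 : EuclideanSpace ℂ (m × m))
      (WithLp.toLp 2 fun p : m × m => Y p.1 p.2) := by
  simp only [Matrix.trace, Matrix.diag, Matrix.mul_apply, PiLp.inner_apply,
    Fintype.sum_prod_type, Matrix.conjTranspose_apply]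
  rw [Finset.sum_comm]
  simp [mul_comm]

theorem norm_trace_conjTranspose_mul_le (X Y : Matrix m m ℂ) :
    ‖(Xᴴ * Y).trace‖ ≤ hsNorm X * hsNorm Y := by
  rw [trace_conjTranspose_mul_eq_inner]
  exact norm_inner_le_norm _ _

theorem trace_conjTranspose_mul_self_eq (X : Matrix m m ℂ) :
    (Xᴴ * X).trace = (hsNorm X ^ 2 : ℝ) := by
  rw [trace_conjTranspose_mul_eq_inner, inner_self_eq_norm_sq_to_K]
  simp [hsNorm]

theorem hsNorm_conjTranspose (X : Matrix m m ℂ) : hsNorm Xᴴ = hsNorm X := by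
  rw [hsNorm, hsNorm, EuclideanSpace.norm_eq, EuclideanSpace.norm_eq]
  simp only [Fintype.sum_prod_type, Matrix.conjTranspose_apply, norm_star]
  rw [Finset.sum_comm]

variable [DecidableEq m]

theorem hsNorm_mul_le_left (A X : Matrix m m ℂ) : hsNorm (A * X) ≤ ‖A‖ * hsNorm X := by
  have hcol : ∀ j, ∑ i, ‖(A * X) i j‖ ^ 2 ≤ ‖A‖ ^ 2 * ∑ i, ‖X i j‖ ^ 2 := fun j => by
    have h := Matrix.l2_opNorm_mulVec A (WithLp.toLp 2 fun i => X i j)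
    have h2 := pow_le_pow_left₀ (norm_nonneg _) h 2
    rw [mul_pow, EuclideanSpace.norm_sq_eq, EuclideanSpace.norm_sq_eq] at h2
    exact h2
  rw [hsNorm, hsNorm, ← Real.sqrt_sq (norm_nonneg A), EuclideanSpace.norm_eq,
    EuclideanSpace.norm_eq, ← Real.sqrt_mul (sq_nonneg _)]
  refine Real.sqrt_le_sqrt ?_
  simp only [Fintype.sum_prod_type]
  rw [Finset.sum_comm (f := fun i j => ‖(A * X) i j‖ ^ 2),
    Finset.sum_comm (f := fun i j => ‖X i j‖ ^ 2), Finset.mul_sum]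
  exact Finset.sum_le_sum fun j _ => hcol j

theorem hsNorm_mul_le_right (X A : Matrix m m ℂ) : hsNorm (X * A) ≤ hsNorm X * ‖A‖ := by
  rw [← hsNorm_conjTranspose, Matrix.conjTranspose_mul, mul_comm (hsNorm X)]
  refine (hsNorm_mul_le_left _ _).trans (le_of_eq ?_)
  rw [hsNorm_conjTranspose, Matrix.l2_opNorm_conjTranspose]

theorem hsNorm_mul_mul_le (A X B : Matrix m m ℂ) :
    hsNorm (A * X * B) ≤ ‖A‖ * hsNorm X * ‖B‖ :=
  (hsNorm_mul_le_right _ _).trans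
    (mul_le_mul_of_nonneg_right (hsNorm_mul_le_left _ _) (norm_nonneg _))

end HilbertSchmidt

/-! ### Comparison of two orthogonal projections -/

section Comparison

variable {m : Type*} [Fintype m]

theorem trace_symmetric_mul {E : Matrix m m ℂ} (hE : Eᴴ = E) (X Y : Matrix m m ℂ) :
    (Xᴴ * (E * E) * Y * (E * E)).trace = ((E * X * E)ᴴ * (E * Y * E)).trace := by
  have h1 : Xᴴ * (E * E) * Y * (E * E) = (Xᴴ * E * E * Y * E) * E := by
    simp only [Matrix.mul_assoc]
  rw [h1, Matrix.trace_mul_comm]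
  simp only [Matrix.conjTranspose_mul, hE, Matrix.mul_assoc]

/-- If `W` is orthogonal to `Q` for the weight `E`, then `W` is no longer than `W + Q`. -/
theorem hsNorm_orthogonal_part_le {E Q W : Matrix m m ℂ} (hE : Eᴴ = E)
    (hQ : (Qᴴ * (E * E) * W * (E * E)).trace = 0) :
    hsNorm (E * W * E) ≤ hsNorm (E * (W + Q) * E) := by
  rw [trace_symmetric_mul hE] at hQ
  have h1 : ((E * (W + Q) * E)ᴴ * (E * W * E)).trace = (hsNorm (E * W * E) ^ 2 : ℝ) := by
    rw [← trace_conjTranspose_mul_self_eq, Matrix.mul_add, Matrix.add_mul,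
      Matrix.conjTranspose_add, Matrix.add_mul, Matrix.trace_add, hQ, add_zero]
  have h2 := norm_trace_conjTranspose_mul_le (E * (W + Q) * E) (E * W * E)
  rw [h1, Complex.norm_real, Real.norm_of_nonneg (sq_nonneg _), sq] at h2
  rcases (hsNorm_nonneg (E * W * E)).eq_or_lt with h0 | h0
  · rw [← h0]; exact hsNorm_nonneg _
  · exact le_of_mul_le_mul_right h2 h0

/-- Weights that differ by a factor in a self-adjoint algebra of operators have the same
orthogonality relations in that algebra. -/
theorem trace_eq_zero_of_weight_mul {X W C ER : Matrix m m ℂ} (hC : Cᴴ = C)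
    (hCR : Commute C ER)
    (h : ((C * C * X * (C * C))ᴴ * (ER * ER) * W * (ER * ER)).trace = 0) :
    (Xᴴ * ((C * ER) * (C * ER)) * W * ((C * ER) * (C * ER))).trace = 0 := by
  have h1 : (C * ER) * (C * ER) = C * C * (ER * ER) := hCR.symm.mul_mul_mul_comm C ER
  have h2 : (C * ER) * (C * ER) = ER * ER * (C * C) := by
    rw [h1]
    exact ((hCR.mul_left hCR).mul_right (hCR.mul_left hCR)).eq
  rw [← h]
  nth_rewrite 1 [h1]
  rw [h2]
  have h4 : Xᴴ * (C * C * (ER * ER)) * W * (ER * ER * (C * C)) =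
      (Xᴴ * (C * C * (ER * ER)) * W * (ER * ER)) * (C * C) := by
    simp only [Matrix.mul_assoc]
  rw [h4, Matrix.trace_mul_comm]
  simp only [Matrix.conjTranspose_mul, hC, Matrix.mul_assoc]

variable [DecidableEq m]

theorem hsNorm_change_weight_le {E E₀ F₀ : Matrix m m ℂ} {κ : ℝ} (hEF : E₀ * F₀ = 1)
    (h₁ : ‖E * F₀‖ ≤ κ) (h₂ : ‖F₀ * E‖ ≤ κ) (X : Matrix m m ℂ) :
    hsNorm (E * X * E) ≤ κ ^ 2 * hsNorm (E₀ * X * E₀) := by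
  have hFE : F₀ * E₀ = 1 := mul_eq_one_comm.mp hEF
  have hEF' : ∀ Z, E₀ * (F₀ * Z) = Z := fun Z => by rw [← Matrix.mul_assoc, hEF, Matrix.one_mul]
  have hFE' : ∀ Z, F₀ * (E₀ * Z) = Z := fun Z => by rw [← Matrix.mul_assoc, hFE, Matrix.one_mul]
  have h : E * X * E = (E * F₀) * (E₀ * X * E₀) * (F₀ * E) := by
    simp only [Matrix.mul_assoc, hFE', hEF']
  have h0 := hsNorm_nonneg (E₀ * X * E₀)
  rw [h]
  calc _ ≤ ‖E * F₀‖ * hsNorm (E₀ * X * E₀) * ‖F₀ * E‖ := hsNorm_mul_mul_le _ _ _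
    _ ≤ κ * hsNorm (E₀ * X * E₀) * κ := by
        have := (norm_nonneg _).trans h₁
        gcongr
    _ = _ := by ring

theorem le_of_sq_le_of_equivalent {x y t w κ η η' : ℝ} (hx : 0 ≤ x) (hy : 0 ≤ y) (hw : 0 ≤ w)
    (hη' : 0 ≤ η') (h : x ^ 2 ≤ t * w * η') (ht : t ≤ κ ^ 2 * x) (hwy : w ≤ κ ^ 2 * y)
    (hη : η' ≤ η) : x ≤ κ ^ 4 * η * y := by
  have hη0 : 0 ≤ η := hη'.trans hη
  rcases hx.eq_or_lt with h0 | h0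
  · rw [← h0]; positivity
  · refine le_of_mul_le_mul_right ?_ h0
    calc x * x = x ^ 2 := (sq x).symm
      _ ≤ (κ ^ 2 * x) * (κ ^ 2 * y) * η := by
          refine h.trans (mul_le_mul (mul_le_mul ht hwy hw (by positivity)) hη hη' (by positivity))
      _ = _ := by ring

/-- The heart of the comparison. Here `T` is the difference of the projections of an operator
with respect to the weights `E` and `E₀`, and `W` is the part of that operator orthogonal to the
subspace with respect to `E₀`. If `D'` preserves that orthogonality, then `T` is small as far as
`D'` approximates the relative weight `D`. -/
theorem hsNorm_sq_le_of_relative_weight {E E₀ F₀ D D' T W : Matrix m m ℂ} (hE : Eᴴ = E)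
    (hE₀ : E₀ᴴ = E₀) (hF₀ : F₀ᴴ = F₀) (hEF : E₀ * F₀ = 1) (hD : E * E = D * (E₀ * E₀))
    (hTW : (Tᴴ * (E * E) * T * (E * E)).trace = (Tᴴ * (E * E) * W * (E * E)).trace)
    (hD' : ((D'ᴴ * T * D')ᴴ * (E₀ * E₀) * W * (E₀ * E₀)).trace = 0) :
    hsNorm (E * T * E) ^ 2 ≤ hsNorm (E₀ * T * E₀) * hsNorm (E₀ * W * E₀) *
      (‖F₀ * D * E₀ - F₀ * D' * E₀‖ * (‖F₀ * D * E₀‖ + ‖F₀ * D' * E₀‖)) := by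
  have hFE : F₀ * E₀ = 1 := mul_eq_one_comm.mp hEF
  have hEF' : ∀ Z, E₀ * (F₀ * Z) = Z := fun Z => by rw [← Matrix.mul_assoc, hEF, Matrix.one_mul]
  have hFE' : ∀ Z, F₀ * (E₀ * Z) = Z := fun Z => by rw [← Matrix.mul_assoc, hFE, Matrix.one_mul]
  have hDE : E * E = (E₀ * E₀) * Dᴴ := by
    have := congrArg Matrix.conjTranspose hD
    simpa only [Matrix.conjTranspose_mul, hE, hE₀] using this
  have key : ∀ B : Matrix m m ℂ, (Tᴴ * (B * (E₀ * E₀)) * W * ((E₀ * E₀) * Bᴴ)).trace =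
      ((E₀ * T * E₀)ᴴ * ((F₀ * B * E₀) * (E₀ * W * E₀) * (F₀ * B * E₀)ᴴ)).trace := fun B => by
    have h1 : Tᴴ * (B * (E₀ * E₀)) * W * ((E₀ * E₀) * Bᴴ) =
        (Tᴴ * (B * (E₀ * E₀)) * W * ((E₀ * E₀) * Bᴴ) * F₀) * E₀ := by
      simp only [Matrix.mul_assoc, hFE, Matrix.mul_one]
    rw [h1, Matrix.trace_mul_comm]
    simp only [Matrix.conjTranspose_mul, hE₀, hF₀, Matrix.mul_assoc, hEF']
  set G := F₀ * D * E₀ with hG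
  set G' := F₀ * D' * E₀ with hG'
  set W₀ := E₀ * W * E₀ with hW₀
  have hzero : ((E₀ * T * E₀)ᴴ * (G' * W₀ * G'ᴴ)).trace = 0 := by
    rw [← key, ← hD']
    have h1 : Tᴴ * (D' * (E₀ * E₀)) * W * ((E₀ * E₀) * D'ᴴ) =
        (Tᴴ * (D' * (E₀ * E₀)) * W * (E₀ * E₀)) * D'ᴴ := by
      simp only [Matrix.mul_assoc]
    rw [h1, Matrix.trace_mul_comm]
    simp only [Matrix.conjTranspose_mul, Matrix.conjTranspose_conjTranspose, Matrix.mul_assoc]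
  have hT : (hsNorm (E * T * E) ^ 2 : ℝ) =
      ((E₀ * T * E₀)ᴴ * ((G - G') * W₀ * Gᴴ + G' * W₀ * (G - G')ᴴ)).trace := by
    rw [← trace_conjTranspose_mul_self_eq, ← trace_symmetric_mul hE, hTW]
    have h1 : (Tᴴ * (E * E) * W * (E * E)).trace = ((E₀ * T * E₀)ᴴ * (G * W₀ * Gᴴ)).trace := by
      rw [← key, ← hDE, ← hD]
    rw [h1, ← sub_zero (((E₀ * T * E₀)ᴴ * (G * W₀ * Gᴴ)).trace), ← hzero, ← Matrix.trace_sub,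
      ← Matrix.mul_sub]
    congr 2
    rw [Matrix.conjTranspose_sub]
    noncomm_ring
  have hle := norm_trace_conjTranspose_mul_le (E₀ * T * E₀)
    ((G - G') * W₀ * Gᴴ + G' * W₀ * (G - G')ᴴ)
  rw [← hT, Complex.norm_real, Real.norm_of_nonneg (sq_nonneg _)] at hle
  refine hle.trans ?_
  rw [mul_assoc (hsNorm (E₀ * T * E₀))]
  refine mul_le_mul_of_nonneg_left ?_ (hsNorm_nonneg (E₀ * T * E₀))
  calc hsNorm ((G - G') * W₀ * Gᴴ + G' * W₀ * (G - G')ᴴ)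
      ≤ ‖G - G'‖ * hsNorm W₀ * ‖Gᴴ‖ + ‖G'‖ * hsNorm W₀ * ‖(G - G')ᴴ‖ :=
        (hsNorm_add_le _ _).trans
          (add_le_add (hsNorm_mul_mul_le _ _ _) (hsNorm_mul_mul_le _ _ _))
    _ = _ := by
        rw [Matrix.l2_opNorm_conjTranspose, Matrix.l2_opNorm_conjTranspose]
        ring

end Comparison

/-! ### The spectral conditional expectation -/

section SpectralCE

open NormedSpace

variable {n q : ℕ}

theorem spectralCE_mem {ρ : Op n q} (hρ : ρ.PosDef) (A : Finset (Fin n)) (Y : Op n q) :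
    spectralCE ρ hρ A Y ∈ localOps q Aᶜ :=
  (exists_isKMSOrthonormalBasis hρ Aᶜ).choose_spec.expansion_mem Y

theorem kmsInner_spectralCE {ρ : Op n q} (hρ : ρ.PosDef) (A : Finset (Fin n)) {X : Op n q}
    (hX : X ∈ localOps q Aᶜ) (Y : Op n q) :
    kmsInner ρ X (spectralCE ρ hρ A Y) = kmsInner ρ X Y := by
  have hB := (exists_isKMSOrthonormalBasis hρ Aᶜ).choose_spec
  rw [← hB.span_eq] at hX
  induction hX using Submodule.span_induction with
  | mem x hx => obtain ⟨i, rfl⟩ := hx; exact hB.inner_expansion i Y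
  | zero => simp [kmsInner]
  | add x y _ _ hx hy =>
    have h1 : ∀ W, kmsInner ρ (x + y) W = kmsInner ρ x W + kmsInner ρ y W := fun W => by
      simp [kmsInner, Matrix.add_mul]
    rw [h1, h1, hx, hy]
  | smul a x _ hx =>
    have h1 : ∀ W, kmsInner ρ (a • x) W = star a * kmsInner ρ x W := fun W => by
      simp [kmsInner]
    rw [h1, h1, hx]

theorem spectralCE_empty {ρ : Op n q} (hρ : ρ.PosDef) (Y : Op n q) : spectralCE ρ hρ ∅ Y = Y := by
  refine (exists_isKMSOrthonormalBasis hρ ∅ᶜ).choose_spec.expansion_eq_self ⟨Matrix.of fun a b =>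
    Y (fun i => a ⟨i, by simp⟩) (fun i => b ⟨i, by simp⟩), ?_⟩
  ext x y
  simp [extendOp]

theorem kmsSuperNorm_le {ρ : Op n q} {N : Op n q →ₗ[ℂ] Op n q} {c : ℝ} (hc : 0 ≤ c)
    (h : ∀ Y, kmsNorm ρ (N Y) ≤ c * kmsNorm ρ Y) : kmsSuperNorm ρ N ≤ ENNReal.ofReal c :=
  iSup_le fun Y => ENNReal.ofReal_le_ofReal (div_le_of_le_mul₀ (Real.sqrt_nonneg _) hc (h Y))

theorem kmsSuperNorm_zero (ρ : Op n q) : kmsSuperNorm ρ 0 = 0 := by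
  refine le_antisymm ((kmsSuperNorm_le le_rfl fun Y => ?_).trans (by simp)) bot_le
  simp [kmsNorm, kmsInner]

namespace ChainHamiltonian

theorem isHermitian_total (H : ChainHamiltonian n q) : H.total.IsHermitian := by
  simp only [total, Matrix.IsHermitian, Matrix.conjTranspose_sum]
  exact Finset.sum_congr rfl fun b _ => H.isHermitian_link b

theorem conjTranspose_exp_neg_smul {K : Op n q} (hK : K.IsHermitian) (u : ℝ) :
    (exp (-(u • K)))ᴴ = exp (-(u • K)) := by
  have : (-(u • K)).IsHermitian := by
    simp [Matrix.IsHermitian, Matrix.conjTranspose_smul, hK.eq]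
  exact this.exp

theorem exists_sqrt_gibbs (H : ChainHamiltonian n q) (β : ℝ) :
    ∃ z : ℝ, 0 < z ∧ CFC.sqrt (H.gibbs β) =
      (z : ℂ) • (exp (-((β / 4) • H.total)) * exp (-((β / 4) • H.total))) := by
  have hH := H.isHermitian_total
  set E := exp (-((β / 4) • H.total)) with hE
  have hEE : exp ((-β) • H.total) = E * E * (E * E) := by
    have hc : ∀ x : Op n q, exp (x + x) = exp x * exp x := fun x =>
      exp_add_of_commute_real (Commute.refl x)
    rw [hE, ← hc, ← hc]
    congr 1
    module
  have hp : (exp ((-β) • H.total)).PosDef := posDef_exp (by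
    simp [Matrix.IsHermitian, Matrix.conjTranspose_smul, hH.eq])
  have hEh : Eᴴ = E := conjTranspose_exp_neg_smul hH _
  obtain ⟨hre, him⟩ := Complex.pos_iff.mp hp.trace_pos
  set Z := (exp ((-β) • H.total)).trace with hZ
  obtain ⟨r, hr⟩ : ∃ r : ℝ, Z = r := ⟨Z.re, Complex.ext rfl (by simpa using him.symm)⟩
  rw [hr, Complex.ofReal_re] at hre
  refine ⟨(Real.sqrt r)⁻¹, by positivity, ?_⟩
  refine CFC.sqrt_unique ?_ ?_
  · rw [gibbs, ← hZ, Matrix.smul_mul, Matrix.mul_smul, smul_smul, hEE, hr]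
    congr 1
    rw [← Complex.ofReal_mul, ← mul_inv, Real.mul_self_sqrt hre.le]
    simp
  · rw [Matrix.nonneg_iff_posSemidef]
    have : (E * E).PosSemidef := by
      have := Matrix.posSemidef_conjTranspose_mul_self E
      rwa [hEh] at this
    refine this.smul ?_
    rw [Complex.zero_le_real]
    positivity

theorem kmsInner_eq_of_sqrt_eq {ρ E : Op n q} {z : ℝ} (h : CFC.sqrt ρ = (z : ℂ) • (E * E))
    (X Y : Op n q) :
    kmsInner ρ X Y = ((z ^ 2 : ℝ) : ℂ) * (Xᴴ * (E * E) * Y * (E * E)).trace := by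
  rw [kmsInner, h]
  simp only [Matrix.mul_smul, Matrix.smul_mul, Matrix.trace_smul, smul_eq_mul]
  push_cast
  ring

theorem kmsNorm_eq_of_sqrt_eq {ρ E : Op n q} {z : ℝ} (hz : 0 < z) (hE : Eᴴ = E)
    (h : CFC.sqrt ρ = (z : ℂ) • (E * E)) (X : Op n q) :
    kmsNorm ρ X = z * hsNorm (E * X * E) := by
  rw [kmsNorm, kmsInner_eq_of_sqrt_eq h, trace_symmetric_mul hE, trace_conjTranspose_mul_self_eq,
    ← Complex.ofReal_mul, Complex.ofReal_re, ← mul_pow,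
    Real.sqrt_sq (mul_nonneg hz.le (hsNorm_nonneg _))]

/-- The comparison of the spectral conditional expectations of `H = K + V` and of its restriction
to `R`, where `K` differs from the restriction only by a term supported away from `A`. The operator
`D'` is an approximation, supported away from `A`, of `D = e^{-βH/2} e^{βK/2}`; its quality is measured
after conjugation with `e^{βK/4}`, which turns `D` into the self-adjoint `e^{βK/4} e^{-βH/2} e^{βK/4}`. -/
theorem kmsSuperNorm_spectralCE_sub_le (H : ChainHamiltonian n q) {A R : Finset (Fin n)}
    {β a η : ℝ} (hβ : 0 ≤ β) {K V L D' : Op n q} (hHK : H.total = K + V)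
    (hKL : K = (H.restrict R).total + L) (hL : L ∈ localOps q Aᶜ) (hLh : L.IsHermitian)
    (hcomm : Commute (H.restrict R).total L)
    (ha : ∀ t : ℝ, |t| ≤ β / 4 → ‖expConj (t • K) V‖ ≤ a) (hD' : D' ∈ localOps q Aᶜ)
    (hη : ‖expConj ((β / 4) • K) (exp (-((β / 2) • (K + V))) * exp ((β / 2) • K)) -
        expConj ((β / 4) • K) D'‖ *
      (‖expConj ((β / 4) • K) (exp (-((β / 2) • (K + V))) * exp ((β / 2) • K))‖ +
        ‖expConj ((β / 4) • K) D'‖) ≤ η) :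
    kmsSuperNorm (H.gibbs β) (H.spectralCE β A - (H.restrict R).spectralCE β A) ≤
      ENNReal.ofReal (Real.exp (a * (β / 4)) ^ 4 * η) := by
  have hη0 : 0 ≤ η := le_trans (by positivity) hη
  refine kmsSuperNorm_le (by positivity) fun Y => ?_
  have hu : 0 ≤ β / 4 := by positivity
  obtain ⟨z, hz, hsq⟩ := H.exists_sqrt_gibbs β
  obtain ⟨z', hz', hsq'⟩ := (H.restrict R).exists_sqrt_gibbs β
  have hRh := (H.restrict R).isHermitian_total
  have hKh : K.IsHermitian := hKL ▸ hRh.add hLh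
  set κ := Real.exp (a * (β / 4)) with hκ
  set E := exp (-((β / 4) • H.total)) with hEdef
  set F := exp ((β / 4) • H.total) with hFdef
  set E₀ := exp (-((β / 4) • K)) with hE₀def
  set F₀ := exp ((β / 4) • K) with hF₀def
  set ER := exp (-((β / 4) • (H.restrict R).total)) with hERdef
  set C := exp (-((β / 4) • L)) with hCdef
  have hE : Eᴴ = E := conjTranspose_exp_neg_smul H.isHermitian_total _
  have hE₀ : E₀ᴴ = E₀ := conjTranspose_exp_neg_smul hKh _
  have hF₀ : F₀ᴴ = F₀ := by
    have := conjTranspose_exp_neg_smul hKh (-(β / 4))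
    simpa using this
  have hC : Cᴴ = C := conjTranspose_exp_neg_smul hLh _
  have hCmem : C ∈ localOps q Aᶜ :=
    exp_mem_localOps (Submodule.neg_mem _ ((localOps q Aᶜ).smul_of_tower_mem _ hL))
  have hEF : E₀ * F₀ = 1 := exp_neg_mul_exp _
  have hFE : F₀ * E₀ = 1 := exp_mul_exp_neg _
  have hEF1 : E * F = 1 := exp_neg_mul_exp _
  have hFE1 : F * E = 1 := exp_mul_exp_neg _
  have hCR : Commute C ER :=
    Commute.exp (((hcomm.symm.smul_left _).smul_right _).neg_left.neg_right)
  have hE₀C : E₀ = C * ER := by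
    rw [hE₀def, hKL, smul_add, neg_add, add_comm, hCdef, hERdef]
    exact exp_add_of_commute_real ((hcomm.symm.smul_left _).smul_right _).neg_left.neg_right
  -- The norms for the two weights are equivalent.
  have hdown := hsNorm_change_weight_le (κ := κ) hEF1
    (by rw [hFdef, hHK]; exact norm_exp_neg_mul_exp_inv_le K V hu ha)
    (by rw [hFdef, hHK]; exact norm_exp_mul_exp_neg_le K V hu ha)
  set P := H.spectralCE β A Y with hP
  set Q := (H.restrict R).spectralCE β A Y with hQ
  have hPmem : P ∈ localOps q Aᶜ := spectralCE_mem _ _ _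
  have hQmem : Q ∈ localOps q Aᶜ := spectralCE_mem _ _ _
  set W := Y - Q with hW
  set T := P - Q with hT
  have hTmem : T ∈ localOps q Aᶜ := Submodule.sub_mem _ hPmem hQmem
  -- `W` is orthogonal to the operators supported away from `A` for the weight of `K` as well.
  have horth : ∀ X ∈ localOps q Aᶜ, (Xᴴ * (E₀ * E₀) * W * (E₀ * E₀)).trace = 0 := by
    intro X hX
    have hX' : C * C * X * (C * C) ∈ localOps q Aᶜ :=
      mul_mem_localOps (mul_mem_localOps (mul_mem_localOps hCmem hCmem) hX)
        (mul_mem_localOps hCmem hCmem)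
    have h1 := kmsInner_spectralCE ((H.restrict R).gibbs_posDef β) A hX' Y
    rw [kmsInner_eq_of_sqrt_eq hsq', kmsInner_eq_of_sqrt_eq hsq'] at h1
    have h2 := mul_left_cancel₀ (Complex.ofReal_ne_zero.mpr (by positivity)) h1
    have h3 : ((C * C * X * (C * C))ᴴ * (ER * ER) * W * (ER * ER)).trace = 0 := by
      rw [hW, Matrix.mul_sub, Matrix.sub_mul, Matrix.trace_sub, sub_eq_zero]
      exact h2.symm
    rw [hE₀C]
    exact trace_eq_zero_of_weight_mul hC hCR h3
  have hTW : (Tᴴ * (E * E) * T * (E * E)).trace = (Tᴴ * (E * E) * W * (E * E)).trace := by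
    have h1 := kmsInner_spectralCE (H.gibbs_posDef β) A hTmem Y
    rw [kmsInner_eq_of_sqrt_eq hsq, kmsInner_eq_of_sqrt_eq hsq] at h1
    have h2 := mul_left_cancel₀ (Complex.ofReal_ne_zero.mpr (by positivity)) h1
    have h3 : T = W - (Y - P) := by rw [hT, hW]; abel
    nth_rewrite 2 [h3]
    rw [Matrix.mul_sub, Matrix.sub_mul, Matrix.trace_sub, sub_eq_self, Matrix.mul_sub,
      Matrix.sub_mul, Matrix.trace_sub, sub_eq_zero]
    exact h2.symm
  set D := exp (-((β / 2) • (K + V))) * exp ((β / 2) • K) with hDdef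
  have hD : E * E = D * (E₀ * E₀) := by
    have hc : ∀ x : Op n q, exp x * exp x = exp (x + x) := fun x =>
      (exp_add_of_commute_real (Commute.refl x)).symm
    have h1 : E * E = exp (-((β / 2) • (K + V))) := by
      rw [hEdef, hHK, hc]; congr 1; module
    have h2 : E₀ * E₀ = exp (-((β / 2) • K)) := by
      rw [hE₀def, hc]; congr 1; module
    rw [h1, h2, hDdef, Matrix.mul_assoc, exp_mul_exp_neg, Matrix.mul_one]
  have hsq₀ := hsNorm_sq_le_of_relative_weight hE hE₀ hF₀ hEF hD hTW
    (horth _ (mul_mem_localOps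
      (mul_mem_localOps (conjTranspose_mem_localOps hD') hTmem) hD'))
  have hWY : hsNorm (E₀ * W * E₀) ≤ hsNorm (E₀ * Y * E₀) := by
    have := hsNorm_orthogonal_part_le hE₀ (horth Q hQmem)
    rwa [hW, sub_add_cancel] at this
  have hmain : hsNorm (E * T * E) ≤ κ ^ 4 * η * hsNorm (E * Y * E) :=
    le_of_sq_le_of_equivalent (hsNorm_nonneg _) (hsNorm_nonneg _) (hsNorm_nonneg _)
      (by positivity) hsq₀ (hdown T) (hWY.trans (hdown Y)) hη
  rw [LinearMap.sub_apply, ← hP, ← hQ, ← hT]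
  rw [kmsNorm_eq_of_sqrt_eq hz hE hsq, kmsNorm_eq_of_sqrt_eq hz hE hsq]
  calc z * hsNorm (E * T * E) ≤ z * (κ ^ 4 * η * hsNorm (E * Y * E)) := by gcongr
    _ = _ := by ring

end ChainHamiltonian

end SpectralCE

/-! ### The geometry of the chain -/

namespace ChainHamiltonian

open NormedSpace

variable {n q : ℕ}

/-- The links with exactly one end in `R`. -/
def cutLinks (R : Finset (Fin n)) : Finset (Fin (n - 1)) :=
  Finset.univ.filter fun b => ¬(leftSite b ∈ R ↔ rightSite b ∈ R)

theorem card_cutLinks (R : Finset (Fin n)) : (cutLinks R).card = numEndpoints R := rfl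

/-- The sum of the link terms over a set of links. -/
noncomputable def linkSum (H : ChainHamiltonian n q) (s : Finset (Fin (n - 1))) : Op n q :=
  ∑ b ∈ s, H.link b

theorem linkSum_mem_localOps (H : ChainHamiltonian n q) {s : Finset (Fin (n - 1))}
    {S : Finset (Fin n)} (h : ∀ b ∈ s, leftSite b ∈ S ∧ rightSite b ∈ S) :
    H.linkSum s ∈ localOps q S :=
  Submodule.sum_mem _ fun b hb => localOps_mono (by
    intro i hi
    rcases Finset.mem_insert.mp hi with rfl | hi
    · exact (h b hb).1
    · rw [Finset.mem_singleton.mp hi]; exact (h b hb).2) (H.link_mem b)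

theorem linkSum_add_compl (H : ChainHamiltonian n q) (s : Finset (Fin (n - 1))) :
    H.linkSum sᶜ + H.linkSum s = H.total :=
  Finset.sum_compl_add_sum s H.link

theorem restrict_total_eq (H : ChainHamiltonian n q) (R : Finset (Fin n)) :
    (H.restrict R).total =
      H.linkSum (Finset.univ.filter fun b => leftSite b ∈ R ∧ rightSite b ∈ R) := by
  rw [total, linkSum, Finset.sum_filter]
  rfl

theorem restrict_total_mem (H : ChainHamiltonian n q) (R : Finset (Fin n)) :
    (H.restrict R).total ∈ localOps q R := by
  rw [restrict_total_eq]
  exact H.linkSum_mem_localOps fun b hb => (Finset.mem_filter.mp hb).2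

theorem linkSum_compl_cutLinks (H : ChainHamiltonian n q) (R : Finset (Fin n)) :
    H.linkSum (cutLinks R)ᶜ = (H.restrict R).total + (H.restrict Rᶜ).total := by
  rw [restrict_total_eq, restrict_total_eq, linkSum, linkSum, linkSum, ← Finset.sum_union]
  · refine Finset.sum_congr ?_ fun _ _ => rfl
    ext b
    simp only [cutLinks, Finset.mem_compl, Finset.mem_filter, Finset.mem_univ, true_and,
      Finset.mem_union]
    tauto
  · rw [Finset.disjoint_left]
    intro b hb hb'
    simp only [Finset.mem_filter, Finset.mem_univ, true_and, Finset.mem_compl] at hb hb'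
    exact hb'.1 hb.1

theorem commute_link (H : ChainHamiltonian n q) {b c : Fin (n - 1)} (h : 2 ≤ Nat.dist b c) :
    Commute (H.link b) (H.link c) := by
  refine commute_of_mem_localOps ?_ (H.link_mem b) (H.link_mem c)
  rw [Finset.disjoint_left]
  intro i hb hc
  simp only [Finset.mem_insert, Finset.mem_singleton, Fin.ext_iff, leftSite, rightSite] at hb hc
  unfold Nat.dist at h
  omega

/-- The part of `linkSum H s` at distance `j` from the link `b`. -/
noncomputable def linkShell (H : ChainHamiltonian n q) (s : Finset (Fin (n - 1)))
    (b : Fin (n - 1)) (j : ℕ) : Op n q :=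
  ∑ c ∈ s.filter fun c : Fin (n - 1) => Nat.dist c b = j, H.link c

theorem commute_linkShell (H : ChainHamiltonian n q) (s s' : Finset (Fin (n - 1)))
    (b : Fin (n - 1)) (i j : ℕ) (h : i + 2 ≤ j) :
    Commute (H.linkShell s b j) (H.linkShell s' b i) :=
  Commute.sum_left _ _ _ fun c hc => Commute.sum_right _ _ _ fun d hd => H.commute_link (by
    have h1 := (Finset.mem_filter.mp hc).2
    have h2 := (Finset.mem_filter.mp hd).2
    unfold Nat.dist at h1 h2 ⊢
    omega)

theorem commute_linkShell_link (H : ChainHamiltonian n q) (s : Finset (Fin (n - 1)))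
    (b : Fin (n - 1)) (j : ℕ) (h : 2 ≤ j) : Commute (H.linkShell s b j) (H.link b) :=
  Commute.sum_left _ _ _ fun c hc => H.commute_link (by
    rw [(Finset.mem_filter.mp hc).2]; exact h)

theorem isShellSeq_linkShell (H : ChainHamiltonian n q) (s : Finset (Fin (n - 1)))
    (b : Fin (n - 1)) : IsShellSeq (H.linkShell s b) where
  norm_le j := by
    have hcard : (s.filter fun c : Fin (n - 1) => Nat.dist c b = j).card ≤ 2 := by
      have hsub : (s.filter fun c : Fin (n - 1) => Nat.dist c b = j).image (fun c : Fin (n - 1) => (c : ℕ)) ⊆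
          {(b : ℕ) - j, (b : ℕ) + j} := by
        intro k hk
        obtain ⟨c, hc, rfl⟩ := Finset.mem_image.mp hk
        have := (Finset.mem_filter.mp hc).2
        unfold Nat.dist at this
        rw [Finset.mem_insert, Finset.mem_singleton]
        omega
      rw [← Finset.card_image_of_injective _ Fin.val_injective]
      exact (Finset.card_le_card hsub).trans Finset.card_le_two
    calc ‖H.linkShell s b j‖ ≤ ∑ c ∈ s.filter fun c : Fin (n - 1) => Nat.dist c b = j, (1 : ℝ) :=
          norm_sum_le_of_le _ fun c _ => H.norm_link_le c
      _ ≤ 2 := by simpa using (Nat.cast_le (α := ℝ)).mpr hcard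
  commute i j h := (H.commute_linkShell s s b i j h).symm

theorem shellSum_linkShell (H : ChainHamiltonian n q) (s : Finset (Fin (n - 1)))
    (b : Fin (n - 1)) {N : ℕ} (hN : n ≤ N) : shellSum (H.linkShell s b) N = H.linkSum s := by
  unfold shellSum linkShell linkSum
  refine Finset.sum_fiberwise_of_maps_to (g := fun c : Fin (n - 1) => Nat.dist c b)
    (fun c _ => ?_) H.link
  rw [Finset.mem_range]
  have := c.2
  have := b.2
  unfold Nat.dist
  omega

/-- The evolution in imaginary time of a link term of a chain is bounded independently of the
length of the chain. -/
theorem norm_expConj_link_le (H : ChainHamiltonian n q) (s : Finset (Fin (n - 1)))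
    (b : Fin (n - 1)) {t u : ℝ} (ht : |t| ≤ u) :
    ‖expConj (t • H.linkSum s) (H.link b)‖ ≤ evolBound 2 u := by
  rw [← H.shellSum_linkShell s b le_rfl]
  refine ((H.isShellSeq_linkShell s b).norm_expConj_le_evolBound_of_abs_le
    (H.commute_linkShell_link s b) n ht).trans ?_
  exact mul_le_of_le_one_left (evolBound_nonneg _ _) (H.norm_link_le b)

/-- Dropping the links at distance at least `r + 2` from `b` hardly changes the evolution of the
link term at `b`, even after a further evolution with all links. -/
theorem norm_expConj_link_sub_le (H : ChainHamiltonian n q) {s s' : Finset (Fin (n - 1))}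
    {b : Fin (n - 1)} {r : ℕ} (hss' : ∀ c : Fin (n - 1), Nat.dist c b < r + 2 → (c ∈ s ↔ c ∈ s')) {t u : ℝ}
    (ht : 0 ≤ t) (hu : 0 ≤ u) :
    ‖expConj (u • H.linkSum s) (expConj (-(t • H.linkSum s)) (H.link b)) -
      expConj (u • H.linkSum s) (expConj (-(t • H.linkSum s')) (H.link b))‖ ≤
        2 * evolTail 2 t u r := by
  have heq : ∀ j < 2 + r, H.linkShell s b j = H.linkShell s' b j := fun j hj => by
    refine Finset.sum_congr ?_ fun _ _ => rfl
    ext c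
    simp only [Finset.mem_filter]
    constructor
    · rintro ⟨h1, h2⟩
      exact ⟨(hss' c (by omega)).mp h1, h2⟩
    · rintro ⟨h1, h2⟩
      exact ⟨(hss' c (by omega)).mpr h1, h2⟩
  have h := (H.isShellSeq_linkShell s b).norm_expConj_sub_le (H.isShellSeq_linkShell s' b)
    (H.commute_linkShell s s' b) (H.commute_linkShell_link s b) (H.commute_linkShell_link s' b)
    heq (N := n + (2 + r)) (by omega) ht hu
  rw [H.shellSum_linkShell s b (by omega), H.shellSum_linkShell s' b (by omega)] at h
  refine h.trans ?_
  have := mul_le_of_le_one_left (evolTail_nonneg 2 ht u r) (H.norm_link_le b)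
  linarith

end ChainHamiltonian

/-! ### Constants and distances -/

/-- The tails decay like `exp(-ℓ log ℓ / 2)`. -/
theorem evolTail_le (p : ℕ) {s : ℝ} (hs : 0 ≤ s) (u : ℝ) :
    ∃ C : ℝ, 0 ≤ C ∧ ∀ r : ℕ,
      evolTail p s u r ≤ C * Real.exp (-(1 / 2 * ((r + 3 : ℕ) * Real.log (r + 3 : ℕ)))) := by
  set c := 4 * s * Real.exp (4 * (s + u)) with hc
  have hc0 : 0 ≤ c := by positivity
  set M := Real.exp (4 * p * s + 4 * (p + 1) * u) * Real.exp (4 * u * Real.exp (4 * u)) *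
    Real.exp c with hM
  set C := 36 * Real.exp (Real.exp 1 ^ 3 * (c + 1) ^ 2) with hC
  have hC1 : 1 ≤ C := by
    have := Real.one_le_exp (x := Real.exp 1 ^ 3 * (c + 1) ^ 2) (by positivity)
    rw [hC]; linarith
  refine ⟨M * C, by positivity, fun r => ?_⟩
  -- It suffices to bound the square of `x`, where the factorial appears twice: one factor absorbs
  -- `ℓ ^ ℓ` and the other one is left to absorb the powers.
  set ℓ := r + 3 with hℓ
  set x := c ^ r / r.factorial * Real.exp (1 / 2 * (ℓ * Real.log ℓ)) with hx
  have hℓ0 : (0 : ℝ) < ℓ := by rw [hℓ]; positivity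
  have hf : (0 : ℝ) < ℓ.factorial := by positivity
  have h1 : c ^ r / r.factorial ≤ 6 * (Real.exp 1 * (c + 1)) ^ ℓ / ℓ.factorial := by
    have e1 : c ^ r ≤ (c + 1) ^ ℓ :=
      (pow_le_pow_left₀ hc0 (by linarith) r).trans
        (pow_le_pow_right₀ (by linarith) (by omega))
    have e2 : (ℓ.factorial : ℝ) ≤ (ℓ : ℝ) ^ 3 * r.factorial := by
      have : ℓ.factorial ≤ ℓ ^ 3 * r.factorial := by
        rw [hℓ, Nat.factorial_succ, Nat.factorial_succ, Nat.factorial_succ]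
        calc (r + 2 + 1) * ((r + 1 + 1) * ((r + 1) * r.factorial))
            = ((r + 3) * ((r + 2) * (r + 1))) * r.factorial := by ring
          _ ≤ ((r + 3) * ((r + 3) * (r + 3))) * r.factorial := by gcongr <;> omega
          _ = _ := by ring
      exact_mod_cast this
    have e3 : (ℓ : ℝ) ^ 3 ≤ 6 * Real.exp 1 ^ ℓ := by
      have := Real.pow_div_factorial_le_exp (ℓ : ℝ) hℓ0.le 3
      rw [div_le_iff₀ (by positivity)] at this
      rw [← Real.exp_nat_mul, mul_one]
      norm_num [Nat.factorial] at this
      linarith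
    rw [div_le_div_iff₀ (by positivity) hf, mul_pow (Real.exp 1)]
    calc c ^ r * ℓ.factorial ≤ (c + 1) ^ ℓ * ((ℓ : ℝ) ^ 3 * r.factorial) := by gcongr
      _ ≤ (c + 1) ^ ℓ * ((6 * Real.exp 1 ^ ℓ) * r.factorial) := by gcongr
      _ = _ := by ring
  have h2 : Real.exp (1 / 2 * (ℓ * Real.log ℓ)) ^ 2 ≤ ℓ.factorial * Real.exp 1 ^ ℓ := by
    have e1 := Real.pow_div_factorial_le_exp (ℓ : ℝ) hℓ0.le ℓ
    rw [div_le_iff₀ hf] at e1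
    rw [← Real.exp_nat_mul, ← Real.exp_nat_mul, mul_one]
    have e2 : Real.exp ((2 : ℕ) * (1 / 2 * (ℓ * Real.log ℓ))) = (ℓ : ℝ) ^ ℓ := by
      rw [show ((2 : ℕ) : ℝ) * (1 / 2 * (ℓ * Real.log ℓ)) = ℓ * Real.log ℓ by push_cast; ring,
        Real.exp_nat_mul, Real.exp_log hℓ0]
    rw [e2]; linarith
  have hx0 : 0 ≤ x := by positivity
  have hxC : x ≤ C := by
    rw [← pow_le_pow_iff_left₀ hx0 (by linarith) two_ne_zero]
    have e1 := Real.pow_div_factorial_le_exp (Real.exp 1 ^ 3 * (c + 1) ^ 2) (by positivity) ℓ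
    calc x ^ 2 ≤ (6 * (Real.exp 1 * (c + 1)) ^ ℓ / ℓ.factorial) ^ 2 *
          (ℓ.factorial * Real.exp 1 ^ ℓ) := by
          rw [hx, mul_pow]; gcongr
      _ = 36 * ((Real.exp 1 ^ 3 * (c + 1) ^ 2) ^ ℓ / ℓ.factorial) := by
          rw [mul_pow (Real.exp 1) (c + 1), mul_pow (Real.exp 1 ^ 3), ← pow_mul, ← pow_mul]
          field_simp
          ring
      _ ≤ C := by rw [hC]; gcongr
      _ ≤ C ^ 2 := by nlinarith
  have he : evolTail p s u r = M * (c ^ r / r.factorial) := rfl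
  rw [he, mul_assoc M]
  refine mul_le_mul_of_nonneg_left ?_ (by positivity)
  rw [Real.exp_neg, ← div_eq_mul_inv, le_div_iff₀ (Real.exp_pos _)]
  exact hxC

section Distance

variable {n : ℕ}

theorem siteDist_le_dist {A B : Finset (Fin n)} {ℓ : ℕ} (h : siteDist A B = ℓ) {i j : Fin n}
    (hi : i ∈ A) (hj : j ∈ B) : ℓ ≤ Nat.dist i j := by
  have : siteDist A B ≤ (Nat.dist i j : ℕ) := (iInf₂_le i hi).trans (iInf₂_le j hj)
  rw [h] at this
  exact_mod_cast this

theorem nonempty_of_siteDist_eq {A B : Finset (Fin n)} {ℓ : ℕ} (h : siteDist A B = ℓ) :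
    A.Nonempty ∧ B.Nonempty := by
  constructor <;>
  · rw [Finset.nonempty_iff_ne_empty]
    rintro rfl
    simp [siteDist] at h

theorem eq_empty_of_siteDist_eq_top {A B : Finset (Fin n)} (h : siteDist A B = ⊤) :
    A = ∅ ∨ B = ∅ := by
  by_contra hne
  push Not at hne
  obtain ⟨i, hi⟩ := hne.1
  obtain ⟨j, hj⟩ := hne.2
  have : siteDist A B ≤ (Nat.dist i j : ℕ) := (iInf₂_le i hi).trans (iInf₂_le j hj)
  rw [h, top_le_iff] at this
  exact ENat.natCast_ne_top _ this

/-- A set of sites that is neither empty nor the whole chain has an end-point. -/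
theorem one_le_numEndpoints {R : Finset (Fin n)} {i j : Fin n} (hi : i ∈ R) (hj : j ∉ R) :
    1 ≤ numEndpoints R := by
  by_contra h
  have h0 : numEndpoints R = 0 := by omega
  rw [numEndpoints, Finset.card_eq_zero, Finset.filter_eq_empty_iff] at h0
  have hall : ∀ k (hk : k < n), (⟨k, hk⟩ : Fin n) ∈ R ↔ (⟨0, by omega⟩ : Fin n) ∈ R := by
    intro k
    induction k with
    | zero => exact fun _ => Iff.rfl
    | succ k ih =>
      intro hk
      have := h0 (Finset.mem_univ (⟨k, by omega⟩ : Fin (n - 1)))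
      rw [not_not] at this
      exact this.symm.trans (ih (by omega))
  exact hj ((hall j j.2).mpr ((hall i i.2).mp hi))

end Distance

/-! ### Quasi-locality -/

namespace ChainHamiltonian

open NormedSpace

variable {n q : ℕ}

theorem norm_expConj_linkSum_le (H : ChainHamiltonian n q) (s s' : Finset (Fin (n - 1)))
    {t u : ℝ} (ht : |t| ≤ u) :
    ‖expConj (t • H.linkSum s) (H.linkSum s')‖ ≤ s'.card * evolBound 2 u := by
  rw [linkSum, linkSum, expConj_sum]
  refine (norm_sum_le_of_le _ fun b _ => H.norm_expConj_link_le s b ht).trans ?_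
  simp

theorem norm_expConj_expConj_linkSum_le (H : ChainHamiltonian n q)
    (s s' : Finset (Fin (n - 1))) {t u : ℝ} (ht : t ∈ Set.Icc 0 (2 * u)) :
    ‖expConj (u • H.linkSum s) (expConj (-(t • H.linkSum s)) (H.linkSum s'))‖ ≤
      s'.card * evolBound 2 u := by
  rw [expConj_expConj (((Commute.refl _).smul_left _).smul_right _).neg_right, ← neg_smul,
    ← add_smul]
  exact H.norm_expConj_linkSum_le s s' (abs_le.mpr ⟨by linarith [ht.2], by linarith [ht.1]⟩)

/-- A bound without decay, obtained with `0` as the approximation of the relative weight. -/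
theorem kmsSuperNorm_spectralCE_sub_le_exp (H : ChainHamiltonian n q) {A R : Finset (Fin n)}
    (hAR : A ⊆ R) {β : ℝ} (hβ : 0 ≤ β) :
    kmsSuperNorm (H.gibbs β) (H.spectralCE β A - (H.restrict R).spectralCE β A) ≤
      ENNReal.ofReal (Real.exp (numEndpoints R * (8 * (β / 4) * evolBound 2 (β / 4)))) := by
  set a := numEndpoints R * evolBound 2 (β / 4) with ha
  have hG := norm_interaction_le ((β / 4) • H.linkSum (cutLinks R)ᶜ) (H.linkSum (cutLinks R)ᶜ)
    (H.linkSum (cutLinks R)) (s := β / 2) (a := a) (by positivity) fun t ht =>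
      H.norm_expConj_expConj_linkSum_le _ _ ⟨ht.1, by linarith [ht.2]⟩
  refine (H.kmsSuperNorm_spectralCE_sub_le (A := A) (R := R) (a := a) (D' := 0)
    (η := Real.exp (a * (β / 2)) * Real.exp (a * (β / 2))) hβ
    (H.linkSum_add_compl (cutLinks R)).symm (H.linkSum_compl_cutLinks R)
    (localOps_mono (Finset.compl_subset_compl.mpr hAR) (H.restrict_total_mem Rᶜ))
    (H.restrict Rᶜ).isHermitian_total
    (commute_of_mem_localOps disjoint_compl_right (H.restrict_total_mem R)
      (H.restrict_total_mem Rᶜ))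
    (fun t ht => H.norm_expConj_linkSum_le _ _ ht) (Submodule.zero_mem _) ?_).trans
    (le_of_eq ?_)
  · rw [expConj_zero_right, sub_zero, norm_zero, add_zero]
    gcongr
  · rw [← Real.exp_nat_mul, ← Real.exp_add, ← Real.exp_add]
    congr 2
    rw [ha]
    push_cast
    ring

/-- The bound with decay, in terms of the error `ε` that is made for a single link. -/
theorem kmsSuperNorm_spectralCE_sub_le_of_dist (H : ChainHamiltonian n q)
    {A R : Finset (Fin n)} (hAR : A ⊆ R) {β : ℝ} (hβ : 0 ≤ β) {r : ℕ}
    (hdist : ∀ i ∈ A, ∀ j ∉ R, r + 3 ≤ Nat.dist i j) {ε : ℝ}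
    (hε : ε = numEndpoints R * (2 * evolTail 2 (β / 2) (β / 4) r)) :
    kmsSuperNorm (H.gibbs β) (H.spectralCE β A - (H.restrict R).spectralCE β A) ≤
      ENNReal.ofReal (3 * (β / 2) * ε *
        Real.exp (16 * (β / 4) * (numEndpoints R * evolBound 2 (β / 4)) +
          8 * (β / 4) * ε)) := by
  set a := numEndpoints R * evolBound 2 (β / 4) with ha
  have ha0 : 0 ≤ a := mul_nonneg (by positivity) (evolBound_nonneg _ _)
  have hε0 : 0 ≤ ε := by
    have := evolTail_nonneg 2 (s := β / 2) (by positivity) (β / 4) r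
    rw [hε]; positivity
  have hβ2 : 0 ≤ β / 2 := by positivity
  -- The links away from `A`, among those that are not cut.
  set s' : Finset (Fin (n - 1)) :=
    (cutLinks R)ᶜ.filter fun c => leftSite c ∈ Aᶜ ∧ rightSite c ∈ Aᶜ with hs'
  set K := H.linkSum (cutLinks R)ᶜ with hK
  set K' := H.linkSum s' with hK'
  set V := H.linkSum (cutLinks R) with hV
  have hnear : ∀ b ∈ cutLinks R, ∀ c : Fin (n - 1), Nat.dist c b < r + 2 →
      leftSite c ∈ Aᶜ ∧ rightSite c ∈ Aᶜ := by
    intro b hb c hc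
    have hb' : leftSite b ∉ R ∨ rightSite b ∉ R := by
      have := (Finset.mem_filter.mp hb).2
      tauto
    rw [Finset.mem_compl, Finset.mem_compl]
    unfold Nat.dist at hdist hc
    constructor <;> intro hcA <;> rcases hb' with hb' | hb' <;>
    · have := hdist _ hcA _ hb'
      simp only [leftSite, rightSite] at this
      omega
  have hVmem : V ∈ localOps q Aᶜ :=
    H.linkSum_mem_localOps fun b hb => hnear b hb b (by simp [Nat.dist_self])
  have hK'mem : K' ∈ localOps q Aᶜ :=
    H.linkSum_mem_localOps fun b hb => (Finset.mem_filter.mp hb).2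
  set D' := exp (-((β / 2) • (K' + V))) * exp ((β / 2) • K') with hD'
  have hD'mem : D' ∈ localOps q Aᶜ :=
    mul_mem_localOps
      (exp_mem_localOps (Submodule.neg_mem _ ((localOps q Aᶜ).smul_of_tower_mem _
        (Submodule.add_mem _ hK'mem hVmem))))
      (exp_mem_localOps ((localOps q Aᶜ).smul_of_tower_mem _ hK'mem))
  have hA : ∀ t ∈ Set.Icc 0 (β / 2),
      ‖expConj ((β / 4) • K) (expConj (-(t • K)) V)‖ ≤ a := fun t ht =>
    H.norm_expConj_expConj_linkSum_le _ _ ⟨ht.1, by linarith [ht.2]⟩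
  have hAB : ∀ t ∈ Set.Icc 0 (β / 2), ‖expConj ((β / 4) • K) (expConj (-(t • K)) V) -
      expConj ((β / 4) • K) (expConj (-(t • K')) V)‖ ≤ ε := fun t ht => by
    rw [hV, linkSum, expConj_sum, expConj_sum, expConj_sum, expConj_sum,
      ← Finset.sum_sub_distrib]
    refine (norm_sum_le_of_le _ fun b hb => (H.norm_expConj_link_sub_le (r := r)
      (fun c hc => ?_) ht.1 (by positivity)).trans (mul_le_mul_of_nonneg_left
        (evolTail_mono 2 ht.1 ht.2 (β / 4) r) zero_le_two)).trans (le_of_eq ?_)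
    · rw [hs', Finset.mem_filter]
      exact ⟨fun h => ⟨h, hnear b hb c hc⟩, fun h => h.1⟩
    · rw [Finset.sum_const, nsmul_eq_mul, card_cutLinks, hε]
  set X := expConj ((β / 4) • K) (exp (-((β / 2) • (K + V))) * exp ((β / 2) • K)) with hX
  set X' := expConj ((β / 4) • K) D' with hX'
  set B := Real.exp ((3 * a + 2 * ε) * (β / 2)) with hB
  have h1 : ‖X‖ ≤ B :=
    (norm_interaction_le _ K V hβ2 hA).trans (by rw [hB]; gcongr; linarith)
  have h2 : ‖X - X'‖ ≤ ε * (β / 2) * Real.exp ((3 * a + ε) * (β / 2)) :=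
    norm_interaction_sub_le _ K K' V hβ2 hA hAB
  have h3 : ‖X - X'‖ ≤ ε * (β / 2) * B :=
    h2.trans (by rw [hB]; gcongr; linarith)
  have h4 : ‖X - X'‖ ≤ B := by
    refine h2.trans ?_
    have e1 : ε * (β / 2) ≤ Real.exp (ε * (β / 2)) := by
      linarith [Real.add_one_le_exp (ε * (β / 2))]
    calc _ ≤ Real.exp (ε * (β / 2)) * Real.exp ((3 * a + ε) * (β / 2)) := by gcongr
      _ = B := by rw [hB, ← Real.exp_add]; congr 1; ring
  have h5 : ‖X'‖ ≤ 2 * B := by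
    have : X' = X - (X - X') := by abel
    rw [this]
    exact (norm_sub_le _ _).trans (by linarith)
  refine (H.kmsSuperNorm_spectralCE_sub_le (A := A) (R := R) (a := a) (D' := D')
    (η := ε * (β / 2) * B * (B + 2 * B)) hβ
    (H.linkSum_add_compl (cutLinks R)).symm (H.linkSum_compl_cutLinks R)
    (localOps_mono (Finset.compl_subset_compl.mpr hAR) (H.restrict_total_mem Rᶜ))
    (H.restrict Rᶜ).isHermitian_total
    (commute_of_mem_localOps disjoint_compl_right (H.restrict_total_mem R)
      (H.restrict_total_mem Rᶜ))
    (fun t ht => H.norm_expConj_linkSum_le _ _ ht) hD'mem ?_).trans (le_of_eq ?_)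
  · exact mul_le_mul h3 (add_le_add h1 h5) (by positivity) (by positivity)
  · congr 1
    have e1 : Real.exp (16 * (β / 4) * a + 8 * (β / 4) * ε) =
        Real.exp (a * (β / 4)) ^ 4 * (B * B) := by
      rw [hB, ← Real.exp_nat_mul, ← Real.exp_add, ← Real.exp_add]
      congr 1
      push_cast
      ring
    rw [e1]
    ring

end ChainHamiltonian

theorem mainTheorem11 (β : ℝ) (hβ : 0 ≤ β) (q : ℕ) :
    ∃ c₁ c₂ c₃ : ℝ, 1 ≤ c₁ ∧ 0 < c₂ ∧ 0 < c₃ ∧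
      ∀ (n : ℕ) (H : ChainHamiltonian n q) (A R : Finset (Fin n)), A ⊆ R →
        (∀ ℓ : ℕ, siteDist A Rᶜ = ℓ →
          kmsSuperNorm (H.gibbs β) (H.spectralCE β A - (H.restrict R).spectralCE β A) ≤
            ENNReal.ofReal
              (c₁ ^ numEndpoints R * Real.exp (c₂ * A.card - c₃ * (ℓ * Real.log ℓ)))) ∧
        (siteDist A Rᶜ = ⊤ →
          kmsSuperNorm (H.gibbs β) (H.spectralCE β A - (H.restrict R).spectralCE β A) = 0) := by
  obtain ⟨C, hC0, hC⟩ := evolTail_le 2 (s := β / 2) (by positivity) (β / 4)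
  set b := evolBound 2 (β / 4) with hb
  have hb0 : 0 ≤ b := evolBound_nonneg _ _
  set k := 16 * (β / 4) * b + 16 * (β / 4) * C + 12 * (β / 4) * C + 1 with hk
  have hk0 : 0 ≤ k := by positivity
  refine ⟨Real.exp k, 1, 1 / 2, Real.one_le_exp hk0, one_pos, by norm_num,
    fun n H A R hAR => ⟨fun ℓ hℓ => ?_, fun htop => ?_⟩⟩
  · -- The constants are absorbed into `c₁ ^ m` because `m ≥ 1`.
    obtain ⟨⟨i, hi⟩, j, hj⟩ := nonempty_of_siteDist_eq hℓ
    have hm : (1 : ℝ) ≤ numEndpoints R := by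
      exact_mod_cast one_le_numEndpoints (hAR hi) (Finset.mem_compl.mp hj)
    set m := (numEndpoints R : ℝ) with hm'
    rw [← Real.exp_nat_mul, ← hm', one_mul]
    have hA0 : (0 : ℝ) ≤ A.card := by positivity
    rcases lt_or_ge ℓ 3 with h3 | h3
    · refine (H.kmsSuperNorm_spectralCE_sub_le_exp hAR hβ).trans (ENNReal.ofReal_le_ofReal ?_)
      rw [← Real.exp_add, Real.exp_le_exp, ← hb, ← hm']
      have hlog : (ℓ : ℝ) * Real.log ℓ ≤ 2 := by
        interval_cases ℓ
        · simp
        · simp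
        · have := Real.log_two_lt_d9
          push_cast
          linarith
      have : 8 * (β / 4) * b + 1 ≤ k := by
        rw [hk]
        have : 0 ≤ β / 4 * b := by positivity
        have : 0 ≤ β / 4 * C := by positivity
        nlinarith
      nlinarith
    · obtain ⟨r, rfl⟩ := Nat.exists_eq_add_of_le' h3
      refine (H.kmsSuperNorm_spectralCE_sub_le_of_dist hAR hβ (r := r) (fun i hi j hj =>
        siteDist_le_dist hℓ hi (Finset.mem_compl.mpr hj)) rfl).trans
          (ENNReal.ofReal_le_ofReal ?_)
      rw [← hb, ← hm']
      set w := Real.exp (-(1 / 2 * ((r + 3 : ℕ) * Real.log (r + 3 : ℕ)))) with hw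
      have hw1 : w ≤ 1 := by
        rw [hw, Real.exp_le_one_iff, neg_nonpos]
        have : 0 ≤ Real.log (r + 3 : ℕ) := Real.log_natCast_nonneg _
        positivity
      have hτ := hC r
      have hτ1 : evolTail 2 (β / 2) (β / 4) r ≤ C :=
        hτ.trans (mul_le_of_le_one_right hC0 hw1)
      have hsplit : Real.exp (A.card - 1 / 2 * ((r + 3 : ℕ) * Real.log (r + 3 : ℕ))) =
          Real.exp A.card * w := by
        rw [hw, ← Real.exp_add]; congr 1
      rw [hsplit]
      have e1 : m ≤ Real.exp m := by linarith [Real.add_one_le_exp m]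
      have e2 : 12 * (β / 4) * C ≤ Real.exp (m * (12 * (β / 4) * C)) := by
        have h1 := Real.add_one_le_exp (m * (12 * (β / 4) * C))
        have h2 : 0 ≤ 12 * (β / 4) * C := by positivity
        nlinarith
      have e3 : Real.exp (16 * (β / 4) * (m * b) +
          8 * (β / 4) * (m * (2 * evolTail 2 (β / 2) (β / 4) r))) ≤
          Real.exp (m * (16 * (β / 4) * b + 16 * (β / 4) * C)) := by
        rw [Real.exp_le_exp]
        have : m * (β / 4) * evolTail 2 (β / 2) (β / 4) r ≤ m * (β / 4) * C := by gcongr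
        nlinarith
      calc _ ≤ 3 * (β / 2) * (m * (2 * (C * w))) *
            Real.exp (m * (16 * (β / 4) * b + 16 * (β / 4) * C)) := by gcongr
        _ = m * (12 * (β / 4) * C) *
            Real.exp (m * (16 * (β / 4) * b + 16 * (β / 4) * C)) * w := by ring
        _ ≤ Real.exp m * Real.exp (m * (12 * (β / 4) * C)) *
            Real.exp (m * (16 * (β / 4) * b + 16 * (β / 4) * C)) * w := by gcongr
        _ = Real.exp (m * k) * (1 * w) := by
            rw [← Real.exp_add, ← Real.exp_add, one_mul]
            congr 2
            rw [hk]
            ring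
        _ ≤ Real.exp (m * k) * (Real.exp A.card * w) := by
            gcongr
            exact Real.one_le_exp hA0
  · have hz : H.spectralCE β A - (H.restrict R).spectralCE β A = 0 := by
      rcases eq_empty_of_siteDist_eq_top htop with rfl | hR
      · ext1 Y
        simp [ChainHamiltonian.spectralCE, spectralCE_empty]
      · rw [Finset.compl_eq_empty_iff] at hR
        have : H.restrict R = H := by
          subst hR
          simp [ChainHamiltonian.restrict]
        rw [this, sub_self]
    rw [hz, kmsSuperNorm_zero]
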